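/- Let $\alpha>0$, $\beta>0$ and $N\in\mathbb N$, $N\ge 1$. For $m\in\mathbb R^N$ put $Q(m)=\frac1N\sum_{i=1}^N m_i^2$, and let $$L_{\alpha,N}=[-1+e^{-\alpha\sqrt N},\,1-e^{-\alpha\sqrt N}]^N\setminus\{0\}.$$ For $m\in L_{\alpha,N}$ let $D_N(m)$ be the diagonal matrix with entries $(1-m_i^2)^{-1}+2\beta^2(1-Q(m))$, $i=1,\dots,N$, let $\nu_{D_N(m)}$ be the empirical distribution of its eigenvalues, and let $\mu_m=\nu_{D_N(m)}\boxplus\mu_{\mathrm{sc},\sqrt2\beta}$ be its free additive convolution with the centred semicircle law of variance $2\beta^2$; that is, $\mu_m$ is the unique probability measure on $\mathbb R$ whose Stieltjes transform $s(z)=\int\frac{\mu_m(dx)}{x-z}$ satisfies $$s(z)=\int\frac{\nu_{D_N(m)}(dx)}{x-z-2\beta^2 s(z)}\qquad\text{for all } z\in\mathbb C \text{ with } \operatorname{Im} z>0 .$$ Then for every $m\in L_{\alpha,N}$ one has $\mu_m(\{0\})=0$, the function $x\mapsto\log|x|$ is $\mu_m$-integrable, and $$\int\log|x|\,\mu_m(dx)=\min_{g\le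 1-Q(m)}\left(\beta^2g^2+\frac1N\sum_{i=1}^N\log\left((1-m_i^2)^{-1}+2\beta^2(1-Q(m))-2\beta^2 g\right)\right).$$ The minimum over $g\le 1-Q(m)$ is attained at exactly one point, and this point lies in $[0,1-Q(m)]$. Moreover, the minimum is attained at $g=1-Q(m)$ if and only if the Plefka condition $$2\beta^2\sum_{i=1}^N(1-m_i^2)^2\le N$$ holds. -/

import Mathlib

open MeasureTheory Set

namespace BrayMoore

/-- The squared Euclidean norm per coordinate, `Q(m) = ‖m‖₂² / N`. -/
noncomputable def Q {N : ℕ} (m : EuclideanSpace ℝ (Fin N)) : ℝ :=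
  ‖m‖ ^ 2 / (N : ℝ)

/-- The diagonal matrix `D_N(m)` with entries `(1 - m_i²)⁻¹ + 2 β² (1 - Q(m))`. -/
noncomputable def D {N : ℕ} (β : ℝ) (m : EuclideanSpace ℝ (Fin N)) : Matrix (Fin N) (Fin N) ℝ :=
  Matrix.diagonal fun i => (1 - m i ^ 2)⁻¹ + 2 * β ^ 2 * (1 - Q m)

theorem isHermitian_D {N : ℕ} (β : ℝ) (m : EuclideanSpace ℝ (Fin N)) : (D β m).IsHermitian :=
  Matrix.isHermitian_diagonal _

/-- The set `L_{α,N} = [-1 + e^{-α √N}, 1 - e^{-α √N}]^N \ {0}`. -/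
def L (α : ℝ) (N : ℕ) : Set (EuclideanSpace ℝ (Fin N)) :=
  {m | (∀ i, m i ∈ Icc (-1 + Real.exp (-(α * √(N : ℝ)))) (1 - Real.exp (-(α * √(N : ℝ))))) ∧
    m ≠ 0}

/-- The empirical distribution `(1/N) ∑_j δ_{λ_j(M)}` of the eigenvalues of a symmetric matrix,
counted with multiplicity. -/
noncomputable def empiricalSpectralMeasure {N : ℕ} {M : Matrix (Fin N) (Fin N) ℝ}
    (hM : M.IsHermitian) : Measure ℝ :=
  (N : ENNReal)⁻¹ • ∑ j, Measure.dirac (hM.eigenvalues j)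

/-- `μ` is a free additive convolution of `ν` with the centred semicircle law of variance `σ²`
(supported on `[-2σ, 2σ]`): it is a probability measure whose Stieltjes transform
`s(z) = ∫ μ(dx) / (x - z)` (Mathlib's `resolventTransform μ z`) satisfies
`s(z) = ∫ ν(dx) / (x - z - σ² s(z))` for every `z` in the open upper half-plane. -/
def IsSemicircleConv (ν : Measure ℝ) (σ : ℝ) (μ : Measure ℝ) : Prop :=
  IsProbabilityMeasure μ ∧
    ∀ z : ℂ, 0 < z.im →
      resolventTransform μ z = resolventTransform ν (z + (σ : ℂ) ^ 2 * resolventTransform μ z)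

open Classical in
/-- The free additive convolution of `ν` with the centred semicircle law of variance `σ²`, i.e. the
(unique) probability measure characterised by `IsSemicircleConv`. The value `0` is a dummy for the
case that there is no such measure. -/
noncomputable def semicircleConv (ν : Measure ℝ) (σ : ℝ) : Measure ℝ :=
  if h : ∃ μ, IsSemicircleConv ν σ μ then h.choose else 0

/-- The measure `μ_m`: the free additive convolution of the empirical spectral distribution of
`D_N(m)` with the semicircle law of standard deviation `√2 β`. -/
noncomputable def mu {N : ℕ} (β : ℝ) (m : EuclideanSpace ℝ (Fin N)) : Measure ℝ :=
  semicircleConv (empiricalSpectralMeasure (isHermitian_D β m)) (√2 * β)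

/-- The function `g ↦ β² g² + (1/N) ∑_i log((1 - m_i²)⁻¹ + 2 β² (1 - Q(m)) - 2 β² g)`. -/
noncomputable def R {N : ℕ} (β : ℝ) (m : EuclideanSpace ℝ (Fin N)) (g : ℝ) : ℝ :=
  β ^ 2 * g ^ 2 +
    1 / (N : ℝ) * ∑ i, Real.log ((1 - m i ^ 2)⁻¹ + 2 * β ^ 2 * (1 - Q m) - 2 * β ^ 2 * g)

end BrayMoore

/-!
Write `σ² = 2β²`, `G = 1 - Q(m)`, `λᵢ = (1 - mᵢ²)⁻¹ + σ² G`, and let `s` be the Stieltjes transform of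
`μ = mu β m`. It solves `s(z) = (1/N) ∑ᵢ 1 / (λᵢ - w)` with `w = z + σ² s(z)`. The proof works with
arbitrary weights `pᵢ` in place of `1/N`.

*Minimization.* The derivative of `R` is `σ² (g - ∑ᵢ pᵢ / (λᵢ - σ² g))`, so the critical points are the
real solutions of the equation at `z = 0`. One of them is `G`, because `λᵢ - σ² G = (1 - mᵢ²)⁻¹`.
Dividing out the root `G` leaves a strictly monotone factor, which gives a unique minimizer `g ≤ G`
(`exists_potential_minimizer`), equal to `G` exactly under the Plefka condition. Whether or not `g = G`,
the minimizer satisfies the stability bound `σ² ∑ᵢ pᵢ / (λᵢ - σ² g)² ≤ 1`.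

*Existence of `μ`.* Starting from `-1 / z`, the iterates of the fixed-point equation are Stieltjes
transforms of atomic probability measures, by Schur's complement formula
(`isAtomicResolvent_bordered`); Prokhorov's theorem provides a limit (`exists_subordinated_measure`).
Uniqueness of `μ` is not needed: everything below holds for each solution.

*Boundary value.* Solutions satisfy `σ² ∑ᵢ pᵢ / |λᵢ - w|² ≤ 1`. Comparing this with the same bound at the
minimizer `g`, in the manner of the equality case of the Cauchy-Schwarz inequality, gives
`|w(z) - σ² g|³ ≤ C |z|` near `0` (`IsSubordinated.norm_subord_sub_pow_le`), hence `s(iη) → g` as `η ↓ 0`.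

*Logarithmic potential.* For `η > 0`,
`∫ ½ log (x² + η²) dμ = ∑ᵢ pᵢ log |λᵢ - w(iη)| + σ²/2 Re s(iη)²` (`IsSubordinated.regLogPotential_eq`),
since both sides have the same derivative in `η` and the same behaviour at infinity. As `η ↓ 0` the right
side tends to `R(g)`, and monotone convergence on the left gives the integrability of `log |x|` and the
value of its integral (`integral_log_abs_eq_of_tendsto`).
-/

namespace BrayMoore

open Filter Topology

/-! ### Minimization of the potential -/

section Minimization

variable {ι : Type*} [Fintype ι]

/-- The function `g ↦ σ²/2 g² + ∑ᵢ pᵢ log (λᵢ - σ² g)`; its critical points are the real solutions of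
the fixed-point equation `g = ∑ᵢ pᵢ / (λᵢ - σ² g)`. -/
noncomputable def potential (σ : ℝ) (p lam : ι → ℝ) (g : ℝ) : ℝ :=
  σ ^ 2 / 2 * g ^ 2 + ∑ i, p i * Real.log (lam i - σ ^ 2 * g)

/-- The factor `1 - σ² ∑ᵢ pᵢ / ((λᵢ - σ² g) (λᵢ - σ² G))`. When `G` solves the fixed-point equation,
it is the slope over `[g, G]` of `g ↦ g - ∑ᵢ pᵢ / (λᵢ - σ² g)`. -/
noncomputable def slope (σ : ℝ) (p lam : ι → ℝ) (G g : ℝ) : ℝ :=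
  1 - σ ^ 2 * ∑ i, p i * ((lam i - σ ^ 2 * g)⁻¹ * (lam i - σ ^ 2 * G)⁻¹)

theorem sub_mul_pos_of_le {σ G g a : ℝ} (hG : 0 < a - σ ^ 2 * G) (hg : g ≤ G) :
    0 < a - σ ^ 2 * g := by
  nlinarith [sq_nonneg σ]

/-- Since `G` is a root of `g ↦ g - ∑ᵢ pᵢ / (λᵢ - σ² g)`, this function has the factor `G - g`, and
`slope` is the cofactor: up to `σ²`, the derivative of `potential` has the sign opposite to that of
the strictly decreasing function `slope`. -/
theorem sub_sum_inv_eq {σ : ℝ} {p lam : ι → ℝ} {G g : ℝ}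
    (hG : ∀ i, 0 < lam i - σ ^ 2 * G) (hfix : G = ∑ i, p i * (lam i - σ ^ 2 * G)⁻¹)
    (hg : g ≤ G) :
    g - ∑ i, p i * (lam i - σ ^ 2 * g)⁻¹ = -((G - g) * slope σ p lam G g) := by
  have key : ∀ i, p i * (lam i - σ ^ 2 * G)⁻¹ - p i * (lam i - σ ^ 2 * g)⁻¹
      = (G - g) * (σ ^ 2 * (p i * ((lam i - σ ^ 2 * g)⁻¹ * (lam i - σ ^ 2 * G)⁻¹))) := by
    intro i
    have h1 := (hG i).ne'
    have h2 := (sub_mul_pos_of_le (hG i) hg).ne'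
    field_simp
    ring
  have hsum : ∑ i, p i * (lam i - σ ^ 2 * G)⁻¹ - ∑ i, p i * (lam i - σ ^ 2 * g)⁻¹
      = (G - g) * (σ ^ 2 * ∑ i, p i * ((lam i - σ ^ 2 * g)⁻¹ * (lam i - σ ^ 2 * G)⁻¹)) := by
    rw [← Finset.sum_sub_distrib, Finset.sum_congr rfl fun i _ => key i, Finset.mul_sum,
      Finset.mul_sum]
  unfold slope
  linear_combination hsum + hfix

theorem hasDerivAt_potential {σ : ℝ} {p lam : ι → ℝ} {g : ℝ}
    (hg : ∀ i, 0 < lam i - σ ^ 2 * g) :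
    HasDerivAt (potential σ p lam)
      (σ ^ 2 * (g - ∑ i, p i * (lam i - σ ^ 2 * g)⁻¹)) g := by
  have h1 : HasDerivAt (fun g : ℝ => σ ^ 2 / 2 * g ^ 2) (σ ^ 2 / 2 * (2 * g)) g := by
    simpa using (hasDerivAt_pow 2 g).const_mul (σ ^ 2 / 2)
  have h2 : ∀ i ∈ Finset.univ, HasDerivAt (fun g : ℝ => p i * Real.log (lam i - σ ^ 2 * g))
      (p i * (-(σ ^ 2) / (lam i - σ ^ 2 * g))) g := by
    intro i _
    have : HasDerivAt (fun g : ℝ => lam i - σ ^ 2 * g) (-(σ ^ 2)) g := by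
      simpa using ((hasDerivAt_id g).const_mul (σ ^ 2)).const_sub (lam i)
    exact (this.log (hg i).ne').const_mul (p i)
  refine (h1.add (HasDerivAt.fun_sum h2)).congr_deriv ?_
  rw [mul_sub, Finset.mul_sum, sub_eq_add_neg, ← Finset.sum_neg_distrib]
  congr 1
  · ring
  · exact Finset.sum_congr rfl fun i _ => by rw [div_eq_mul_inv]; ring

theorem slope_strictAntiOn [Nonempty ι] {σ : ℝ} (hσ : 0 < σ) {p lam : ι → ℝ}
    (hp : ∀ i, 0 < p i) {G : ℝ} (hG : ∀ i, 0 < lam i - σ ^ 2 * G) :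
    StrictAntiOn (slope σ p lam G) (Iic G) := by
  intro g hg g' hg' hlt
  have : ∑ i, p i * ((lam i - σ ^ 2 * g)⁻¹ * (lam i - σ ^ 2 * G)⁻¹)
      < ∑ i, p i * ((lam i - σ ^ 2 * g')⁻¹ * (lam i - σ ^ 2 * G)⁻¹) := by
    refine Finset.sum_lt_sum_of_nonempty Finset.univ_nonempty fun i _ => ?_
    have h1 := sub_mul_pos_of_le (hG i) hg'
    have h2 : lam i - σ ^ 2 * g' < lam i - σ ^ 2 * g := by
      have : 0 < σ ^ 2 := by positivity
      nlinarith
    have := hp i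
    have := inv_pos.2 (hG i)
    gcongr
  unfold slope
  have : 0 < σ ^ 2 := by positivity
  nlinarith

theorem continuousOn_slope {σ : ℝ} {p lam : ι → ℝ} {G : ℝ}
    (hG : ∀ i, 0 < lam i - σ ^ 2 * G) : ContinuousOn (slope σ p lam G) (Iic G) := by
  unfold slope
  refine continuousOn_const.sub (continuousOn_const.mul (continuousOn_finsetSum _ fun i _ => ?_))
  refine continuousOn_const.mul (ContinuousOn.mul (ContinuousOn.inv₀ (by fun_prop) ?_)
    continuousOn_const)
  exact fun g hg => (sub_mul_pos_of_le (hG i) hg).ne'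

theorem potential_monotonicity {σ : ℝ} (hσ : 0 < σ) {p lam : ι → ℝ} {G g : ℝ} (hgG : g ≤ G)
    (hG : ∀ i, 0 < lam i - σ ^ 2 * G) (hfix : G = ∑ i, p i * (lam i - σ ^ 2 * G)⁻¹)
    (hpos : ∀ x < g, 0 < slope σ p lam G x)
    (hneg : ∀ x, g < x → x < G → slope σ p lam G x < 0) :
    StrictAntiOn (potential σ p lam) (Iic g) ∧ StrictMonoOn (potential σ p lam) (Icc g G) := by
  have hd : ∀ x ≤ G, HasDerivAt (potential σ p lam) (σ ^ 2 * -((G - x) * slope σ p lam G x)) x := by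
    intro x hx
    rw [← sub_sum_inv_eq hG hfix hx]
    exact hasDerivAt_potential fun i => sub_mul_pos_of_le (hG i) hx
  have hσ2 : 0 < σ ^ 2 := by positivity
  constructor
  · refine strictAntiOn_of_deriv_neg (convex_Iic g)
      (fun x hx => (hd x (le_trans hx hgG)).continuousAt.continuousWithinAt) fun x hx => ?_
    rw [interior_Iic] at hx
    rw [(hd x (hx.le.trans hgG)).deriv]
    have := mul_pos (sub_pos.2 (lt_of_lt_of_le hx hgG)) (hpos x hx)
    nlinarith
  · refine strictMonoOn_of_deriv_pos (convex_Icc g G)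
      (fun x hx => (hd x hx.2).continuousAt.continuousWithinAt) fun x hx => ?_
    rw [interior_Icc] at hx
    rw [(hd x hx.2.le).deriv]
    have := mul_neg_of_pos_of_neg (sub_pos.2 hx.2) (hneg x hx.1 hx.2)
    nlinarith

/-- The minimizer `g` of `potential` below a critical point `G`: it is `G` itself if
`slope σ p lam G G ≥ 0`, and the zero of `slope` in `(0, G)` otherwise. In both cases it solves the
fixed-point equation and satisfies the stability bound `σ² ∑ᵢ pᵢ / (λᵢ - σ² g)² ≤ 1`. -/
theorem exists_potential_minimizer [Nonempty ι] {σ : ℝ} (hσ : 0 < σ) {p lam : ι → ℝ}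
    (hp : ∀ i, 0 < p i) (hlam : ∀ i, 0 < lam i) {G : ℝ} (hG0 : 0 < G)
    (hG : ∀ i, 0 < lam i - σ ^ 2 * G) (hfix : G = ∑ i, p i * (lam i - σ ^ 2 * G)⁻¹) :
    ∃ g ∈ Icc 0 G, g = ∑ i, p i * (lam i - σ ^ 2 * g)⁻¹ ∧
      σ ^ 2 * ∑ i, p i * (lam i - σ ^ 2 * g)⁻¹ ^ 2 ≤ 1 ∧
      StrictAntiOn (potential σ p lam) (Iic g) ∧ StrictMonoOn (potential σ p lam) (Icc g G) ∧
      (g = G ↔ σ ^ 2 * ∑ i, p i * (lam i - σ ^ 2 * G)⁻¹ ^ 2 ≤ 1) := by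
  have hanti := slope_strictAntiOn hσ hp hG
  have hσ2 : 0 < σ ^ 2 := by positivity
  have hslopeG : slope σ p lam G G = 1 - σ ^ 2 * ∑ i, p i * (lam i - σ ^ 2 * G)⁻¹ ^ 2 := by
    simp only [slope, sq]
  rcases le_or_gt (σ ^ 2 * ∑ i, p i * (lam i - σ ^ 2 * G)⁻¹ ^ 2) 1 with hP | hP
  · obtain ⟨h1, h2⟩ := potential_monotonicity hσ le_rfl hG hfix
      (fun x hx => lt_of_le_of_lt (by rw [hslopeG]; linarith) (hanti hx.le self_mem_Iic hx))
      (fun x h h' => absurd h' h.not_gt)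
    exact ⟨G, ⟨hG0.le, le_rfl⟩, hfix, hP, h1, h2, by simpa using hP⟩
  -- `slope` is positive at `0`, because `g - ∑ᵢ pᵢ / (λᵢ - σ² g)` is negative there.
  · have h0 : 0 < slope σ p lam G 0 := by
      have h := sub_sum_inv_eq hG hfix hG0.le
      have : 0 < ∑ i, p i * (lam i - σ ^ 2 * 0)⁻¹ :=
        Finset.sum_pos (fun i _ => mul_pos (hp i) (inv_pos.2 (by simpa using hlam i)))
          Finset.univ_nonempty
      rw [sub_zero] at h
      exact pos_of_mul_pos_right (by linarith : 0 < G * slope σ p lam G 0) hG0.le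
    have h1 : slope σ p lam G G < 0 := by rw [hslopeG]; linarith
    obtain ⟨g, hg, hg0⟩ := intermediate_value_Icc' hG0.le
      ((continuousOn_slope (p := p) hG).mono Icc_subset_Iic_self) ⟨h1.le, h0.le⟩
    have hgG : g < G := lt_of_le_of_ne hg.2 (by rintro rfl; exact h1.ne hg0)
    obtain ⟨m1, m2⟩ := potential_monotonicity hσ hg.2 hG hfix
      (fun x hx => hg0 ▸ hanti (hx.le.trans hg.2) hg.2 hx)
      (fun x h h' => hg0 ▸ hanti hg.2 h'.le h)
    refine ⟨g, hg, ?_, ?_, m1, m2, ?_⟩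
    · have := sub_sum_inv_eq hG hfix hg.2
      rw [hg0] at this
      linarith
    -- `slope σ p lam G g = 0` and `1 / (λᵢ - σ² g) ≤ 1 / (λᵢ - σ² G)`.
    · have : σ ^ 2 * ∑ i, p i * (lam i - σ ^ 2 * g)⁻¹ ^ 2 ≤
          σ ^ 2 * ∑ i, p i * ((lam i - σ ^ 2 * g)⁻¹ * (lam i - σ ^ 2 * G)⁻¹) := by
        gcongr with i _
        · exact (hp i).le
        · rw [sq]
          have h3 := inv_pos.2 (sub_mul_pos_of_le (hG i) hg.2)
          have := hG i
          gcongr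
      unfold slope at hg0
      linarith
    · exact ⟨fun h => absurd h hgG.ne, fun h => absurd h hP.not_ge⟩

end Minimization

/-! ### Stieltjes transforms on the upper half-plane -/

theorem resolventTransform_eq_integral (μ : Measure ℝ) (z : ℂ) :
    resolventTransform μ z = ∫ x : ℝ, ((x : ℂ) - z)⁻¹ ∂μ := by
  simp [resolventTransform_def, resolvent, Ring.inverse_eq_inv']

theorem ofReal_sub_ne_zero {z : ℂ} (hz : 0 < z.im) (x : ℝ) : (x : ℂ) - z ≠ 0 := by
  intro h
  have := congrArg Complex.im h
  simp at this
  exact hz.ne' this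

theorem norm_inv_ofReal_sub_le {z : ℂ} (hz : 0 < z.im) (x : ℝ) : ‖((x : ℂ) - z)⁻¹‖ ≤ z.im⁻¹ := by
  rw [norm_inv]
  refine inv_anti₀ hz ?_
  calc z.im = |((x : ℂ) - z).im| := by simp [abs_of_pos hz]
    _ ≤ _ := Complex.abs_im_le_norm _

theorem continuous_inv_ofReal_sub {z : ℂ} (hz : 0 < z.im) :
    Continuous fun x : ℝ => ((x : ℂ) - z)⁻¹ :=
  Continuous.inv₀ (by fun_prop) (ofReal_sub_ne_zero hz)

theorem inv_ofReal_sub_im (x : ℝ) (z : ℂ) :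
    (((x : ℂ) - z)⁻¹).im = z.im * ‖((x : ℂ) - z)⁻¹‖ ^ 2 := by
  rw [Complex.inv_im, norm_inv, inv_pow, Complex.normSq_eq_norm_sq]
  simp [div_eq_mul_inv]

theorem integrable_inv_ofReal_sub (μ : Measure ℝ) [IsFiniteMeasure μ] {z : ℂ} (hz : 0 < z.im) :
    Integrable (fun x : ℝ => ((x : ℂ) - z)⁻¹) μ :=
  Integrable.of_bound (continuous_inv_ofReal_sub hz).aestronglyMeasurable z.im⁻¹
    (ae_of_all _ (norm_inv_ofReal_sub_le hz))

theorem norm_resolventTransform_le (μ : Measure ℝ) [IsProbabilityMeasure μ] {z : ℂ}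
    (hz : 0 < z.im) : ‖resolventTransform μ z‖ ≤ z.im⁻¹ := by
  rw [resolventTransform_eq_integral]
  simpa using norm_integral_le_of_norm_le_const (μ := μ) (ae_of_all _ (norm_inv_ofReal_sub_le hz))

theorem resolventTransform_im (μ : Measure ℝ) [IsFiniteMeasure μ] {z : ℂ} (hz : 0 < z.im) :
    (resolventTransform μ z).im = ∫ x : ℝ, z.im * ‖((x : ℂ) - z)⁻¹‖ ^ 2 ∂μ := by
  rw [resolventTransform_eq_integral, ← RCLike.im_eq_complex_im,
    ← integral_im (integrable_inv_ofReal_sub μ hz)]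
  exact integral_congr_ae (ae_of_all _ fun x => inv_ofReal_sub_im x z)

theorem resolventTransform_im_nonneg (μ : Measure ℝ) [IsFiniteMeasure μ] {z : ℂ} (hz : 0 < z.im) :
    0 ≤ (resolventTransform μ z).im := by
  rw [resolventTransform_im μ hz]
  exact integral_nonneg fun x => by positivity

theorem resolventTransform_mul_I_im (μ : Measure ℝ) [IsFiniteMeasure μ] {η : ℝ} (hη : 0 < η) :
    (resolventTransform μ (η * Complex.I)).im = ∫ x : ℝ, η / (x ^ 2 + η ^ 2) ∂μ := by
  rw [resolventTransform_im μ (by simpa using hη)]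
  refine integral_congr_ae (ae_of_all _ fun x => ?_)
  have : ‖(x : ℂ) - η * Complex.I‖ ^ 2 = x ^ 2 + η ^ 2 := by
    rw [← Complex.normSq_eq_norm_sq, Complex.normSq_apply]
    simp; ring
  simp only [norm_inv, inv_pow, this]
  simp [div_eq_mul_inv]

theorem differentiableAt_resolventTransform (μ : Measure ℝ) [IsFiniteMeasure μ] {z : ℂ}
    (hz : 0 < z.im) : DifferentiableAt ℂ (resolventTransform μ) z := by
  refine (hasDerivAt_resolventTransform z ?_).differentiableAt
  rintro ⟨x, -, rfl⟩
  simp at hz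

theorem integrable_div_sq_add_sq (μ : Measure ℝ) [IsFiniteMeasure μ] {η : ℝ} (hη : 0 < η) :
    Integrable (fun x : ℝ => η / (x ^ 2 + η ^ 2)) μ := by
  refine Integrable.of_bound (C := η⁻¹) (Continuous.aestronglyMeasurable ?_)
    (ae_of_all _ fun x => ?_)
  · exact Continuous.div₀ (by fun_prop) (by fun_prop) fun x => by positivity
  · rw [Real.norm_of_nonneg (by positivity), div_le_iff₀ (by positivity)]
    have : 0 ≤ η⁻¹ * x ^ 2 := by positivity
    have : η⁻¹ * η ^ 2 = η := by field_simp
    linarith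

/-- The second moment can be read off the Stieltjes transform `s` at infinity:
`η² (1 - η Im s(iη)) = ∫ η² x² / (x² + η²) μ(dx)`, and the integrand increases to `x²`, so that
Fatou's lemma applies. -/
theorem lintegral_sq_le_of_resolventTransform (μ : Measure ℝ) [IsProbabilityMeasure μ] {C : ℝ}
    (h : ∀ η : ℝ, 1 ≤ η → η ^ 2 * (1 - η * (resolventTransform μ (η * Complex.I)).im) ≤ C) :
    ∫⁻ x : ℝ, ENNReal.ofReal (x ^ 2) ∂μ ≤ ENNReal.ofReal C := by
  have hlim : ∀ x : ℝ, Tendsto (fun η : ℝ => η ^ 2 * (1 - η * (η / (x ^ 2 + η ^ 2)))) atTop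
      (𝓝 (x ^ 2)) := by
    intro x
    have h0 : Tendsto (fun η : ℝ => x ^ 2 / η ^ 2) atTop (𝓝 0) :=
      tendsto_const_nhds.div_atTop (tendsto_pow_atTop two_ne_zero)
    have h1 : Tendsto (fun η : ℝ => x ^ 2 * (x ^ 2 / η ^ 2 + 1)⁻¹) atTop (𝓝 (x ^ 2)) := by
      simpa using ((h0.add_const 1).inv₀ (by norm_num)).const_mul (x ^ 2)
    refine h1.congr' ?_
    filter_upwards [eventually_gt_atTop 0] with η hη
    have : x ^ 2 + η ^ 2 ≠ 0 := by positivity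
    field_simp
    ring
  have hint : ∀ η : ℝ, 1 ≤ η →
      ∫⁻ x : ℝ, ENNReal.ofReal (η ^ 2 * (1 - η * (η / (x ^ 2 + η ^ 2)))) ∂μ ≤ ENNReal.ofReal C := by
    intro η hη
    have hη0 : 0 < η := by linarith
    have hi := (integrable_div_sq_add_sq μ hη0).const_mul η
    have hi1 : Integrable (fun x : ℝ => 1 - η * (η / (x ^ 2 + η ^ 2))) μ :=
      (integrable_const (1 : ℝ)).sub hi
    rw [← ofReal_integral_eq_lintegral_ofReal (hi1.const_mul (η ^ 2))]
    · refine ENNReal.ofReal_le_ofReal ?_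
      rw [integral_const_mul, integral_sub (integrable_const _) hi, integral_const_mul,
        ← resolventTransform_mul_I_im μ hη0]
      simpa using h η hη
    · refine ae_of_all _ fun x => mul_nonneg (by positivity) ?_
      rw [← mul_div_assoc, sub_nonneg]
      exact div_le_one_of_le₀ (by nlinarith [sq_nonneg x]) (by positivity)
  have hseq : Tendsto (fun n : ℕ => (n : ℝ) + 1) atTop atTop :=
    tendsto_atTop_add_const_right _ _ tendsto_natCast_atTop_atTop
  calc ∫⁻ x : ℝ, ENNReal.ofReal (x ^ 2) ∂μ
      = ∫⁻ x : ℝ, liminf (fun n : ℕ => ENNReal.ofReal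
          (((n : ℝ) + 1) ^ 2 * (1 - ((n : ℝ) + 1) * (((n : ℝ) + 1) / (x ^ 2 + ((n : ℝ) + 1) ^ 2)))))
          atTop ∂μ := by
        refine lintegral_congr fun x => ?_
        exact (ENNReal.tendsto_ofReal ((hlim x).comp hseq)).liminf_eq.symm
    _ ≤ liminf (fun n : ℕ => ∫⁻ x : ℝ, ENNReal.ofReal
          (((n : ℝ) + 1) ^ 2 * (1 - ((n : ℝ) + 1) * (((n : ℝ) + 1) / (x ^ 2 + ((n : ℝ) + 1) ^ 2))))
          ∂μ) atTop := by
        refine lintegral_liminf_le fun n => ?_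
        fun_prop
    _ ≤ ENNReal.ofReal C :=
        liminf_le_of_le (by isBoundedDefault) fun b hb => by
          obtain ⟨n, hn⟩ := hb.exists
          exact hn.trans (hint _ (by linarith [(Nat.cast_nonneg n : (0 : ℝ) ≤ n)]))

/-! ### The fixed-point equation -/

section FixedPoint

variable {ι : Type*} [Fintype ι]

/-- The Stieltjes transform `w ↦ ∑ᵢ pᵢ / (λᵢ - w)` of the measure with mass `pᵢ` at `λᵢ`, as an
explicit sum. -/
noncomputable def weightedResolvent (p lam : ι → ℝ) (w : ℂ) : ℂ :=
  ∑ i, (p i : ℂ) * ((lam i : ℂ) - w)⁻¹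

/-- The subordination function `z ↦ z + σ² s(z)`, where `s` is the Stieltjes transform of `μ`. -/
noncomputable def subord (σ : ℝ) (μ : Measure ℝ) (z : ℂ) : ℂ :=
  z + (σ : ℂ) ^ 2 * resolventTransform μ z

/-- `μ` solves the fixed-point equation `s(z) = ∑ᵢ pᵢ / (λᵢ - z - σ² s(z))` on the upper half-plane.
For a probability measure `μ` and weights `pᵢ` of sum `1`, this means that `μ` is the free
convolution of `∑ᵢ pᵢ δ_{λᵢ}` with the semicircle law of variance `σ²`. -/
def IsSubordinated (p lam : ι → ℝ) (σ : ℝ) (μ : Measure ℝ) : Prop :=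
  ∀ z : ℂ, 0 < z.im → resolventTransform μ z =
    weightedResolvent p lam (z + (σ : ℂ) ^ 2 * resolventTransform μ z)

theorem weightedResolvent_im (p lam : ι → ℝ) (w : ℂ) :
    (weightedResolvent p lam w).im = w.im * ∑ i, p i * ‖((lam i : ℂ) - w)⁻¹‖ ^ 2 := by
  simp only [weightedResolvent, Complex.im_sum, Complex.im_ofReal_mul, inv_ofReal_sub_im,
    Finset.mul_sum]
  exact Finset.sum_congr rfl fun i _ => by ring

/-- A uniform second moment bound, valid for solutions of the fixed-point equation (`ρ = μ`) and for
one step of the fixed-point iteration (from `ρ` to `μ`). -/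
theorem lintegral_sq_le_of_subordination {p lam : ι → ℝ} (hp : ∀ i, 0 ≤ p i)
    (hp1 : ∑ i, p i = 1) {σ A : ℝ} (hA : ∀ i, |lam i| ≤ A) (μ ρ : Measure ℝ)
    [IsProbabilityMeasure μ] [IsProbabilityMeasure ρ]
    (h : ∀ z : ℂ, 0 < z.im → resolventTransform μ z =
      weightedResolvent p lam (z + (σ : ℂ) ^ 2 * resolventTransform ρ z)) :
    ∫⁻ x : ℝ, ENNReal.ofReal (x ^ 2) ∂μ ≤ ENNReal.ofReal ((A + σ ^ 2) ^ 2 + σ ^ 2) := by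
  refine lintegral_sq_le_of_resolventTransform μ fun η hη => ?_
  have hη0 : 0 < η := by linarith
  have him : 0 < ((η : ℂ) * Complex.I).im := by simpa using hη0
  set z : ℂ := η * Complex.I with hz
  have hzi : z.im = η := by simp [hz]
  have hzr : z.re = 0 := by simp [hz]
  set t := resolventTransform ρ z with ht
  have ht0 : 0 ≤ t.im := resolventTransform_im_nonneg ρ him
  have ht1 : ‖t‖ ≤ η⁻¹ := by simpa [hz] using norm_resolventTransform_le ρ him
  have htr : |t.re| ≤ 1 :=
    ((Complex.abs_re_le_norm t).trans ht1).trans (inv_le_one_of_one_le₀ hη)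
  have hti : t.im ≤ η⁻¹ := ((le_abs_self _).trans (Complex.abs_im_le_norm t)).trans ht1
  rw [h z him, weightedResolvent_im]
  set w := z + (σ : ℂ) ^ 2 * t with hw
  have hwi : w.im = η + σ ^ 2 * t.im := by
    rw [hw, Complex.add_im, hzi, ← Complex.ofReal_pow, Complex.im_ofReal_mul]
  have hwr : w.re = σ ^ 2 * t.re := by
    rw [hw, Complex.add_re, hzr, ← Complex.ofReal_pow, Complex.re_ofReal_mul, zero_add]
  have hy : η ≤ w.im := by rw [hwi]; nlinarith [sq_nonneg σ]
  have key : ∀ i, η ^ 2 * (1 - η * w.im * ‖((lam i : ℂ) - w)⁻¹‖ ^ 2) ≤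
      (A + σ ^ 2) ^ 2 + σ ^ 2 := by
    intro i
    have hn : ‖(lam i : ℂ) - w‖ ^ 2 = (lam i - w.re) ^ 2 + w.im ^ 2 := by
      rw [← Complex.normSq_eq_norm_sq, Complex.normSq_apply]
      simp; ring
    have ha : (lam i - w.re) ^ 2 ≤ (A + σ ^ 2) ^ 2 := by
      refine sq_le_sq' ?_ ?_ <;> rw [hwr] <;>
        nlinarith [abs_le.1 (hA i), abs_le.1 htr, sq_nonneg σ]
    have hb : w.im ^ 2 - η * w.im ≤ w.im * σ ^ 2 * η⁻¹ := by
      have : w.im * (σ ^ 2 * t.im) ≤ w.im * (σ ^ 2 * η⁻¹) := by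
        have : 0 ≤ w.im := by linarith
        gcongr
      nlinarith
    rw [norm_inv, inv_pow, hn]
    have hwpos : 0 < w.im := by linarith
    have hden : 0 < (lam i - w.re) ^ 2 + w.im ^ 2 := by positivity
    rw [show η ^ 2 * (1 - η * w.im * ((lam i - w.re) ^ 2 + w.im ^ 2)⁻¹) =
      η ^ 2 * ((lam i - w.re) ^ 2 + (w.im ^ 2 - η * w.im)) / ((lam i - w.re) ^ 2 + w.im ^ 2) by
        field_simp; ring]
    rw [div_le_iff₀ hden]
    have h1 : η ^ 2 * (lam i - w.re) ^ 2 ≤ w.im ^ 2 * (A + σ ^ 2) ^ 2 := by gcongr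
    have h2 : η ^ 2 * (w.im ^ 2 - η * w.im) ≤ w.im ^ 2 * σ ^ 2 := by
      calc η ^ 2 * (w.im ^ 2 - η * w.im) ≤ η ^ 2 * (w.im * σ ^ 2 * η⁻¹) := by gcongr
        _ = η * w.im * σ ^ 2 := by field_simp
        _ ≤ w.im * w.im * σ ^ 2 := by gcongr
        _ = _ := by ring
    have h3 : 0 ≤ ((A + σ ^ 2) ^ 2 + σ ^ 2) * (lam i - w.re) ^ 2 := by positivity
    nlinarith
  calc η ^ 2 * (1 - η * (w.im * ∑ i, p i * ‖((lam i : ℂ) - w)⁻¹‖ ^ 2))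
      = ∑ i, p i * (η ^ 2 * (1 - η * w.im * ‖((lam i : ℂ) - w)⁻¹‖ ^ 2)) := by
        conv_lhs => rw [← hp1]
        simp only [Finset.mul_sum, mul_sub, Finset.sum_sub_distrib, mul_one]
        congr 1 <;> exact Finset.sum_congr rfl fun i _ => by ring
    _ ≤ ∑ i, p i * ((A + σ ^ 2) ^ 2 + σ ^ 2) :=
        Finset.sum_le_sum fun i _ => mul_le_mul_of_nonneg_left (key i) (hp i)
    _ = _ := by rw [← Finset.sum_mul, hp1, one_mul]

end FixedPoint

/-! ### Existence of the free convolution -/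

/-- `f` agrees on the upper half-plane with the Stieltjes transform of a finitely supported
probability measure. -/
def IsAtomicResolvent (f : ℂ → ℂ) : Prop :=
  ∃ (κ : Type) (_ : Fintype κ) (q x : κ → ℝ), (∀ k, 0 ≤ q k) ∧ ∑ k, q k = 1 ∧
    ∀ z : ℂ, 0 < z.im → f z = weightedResolvent q x z

theorem IsAtomicResolvent.im_nonneg {f : ℂ → ℂ} (hf : IsAtomicResolvent f) {z : ℂ}
    (hz : 0 < z.im) : 0 ≤ (f z).im := by
  obtain ⟨κ, _, q, x, hq, -, h⟩ := hf
  rw [h z hz, weightedResolvent_im]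
  have : 0 ≤ ∑ k, q k * ‖((x k : ℂ) - z)⁻¹‖ ^ 2 :=
    Finset.sum_nonneg fun k _ => mul_nonneg (hq k) (by positivity)
  positivity

/-- Stieltjes transforms of atomic probability measures are stable under
`f ↦ 1 / (a - z - σ² f(z))`. If `f(z) = ∑ⱼ qⱼ / (xⱼ - z)`, let `H` be the real symmetric matrix
`diag(a, x)` bordered by the entries `σ √qⱼ`. By Schur's complement formula the corner entry of
`(H - z)⁻¹` is the function in question, and by the spectral theorem it is the Stieltjes transform of
the spectral measure of `H` at the corner basis vector. -/
theorem isAtomicResolvent_bordered {f : ℂ → ℂ} (hf : IsAtomicResolvent f) (a σ : ℝ) :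
    IsAtomicResolvent fun z => ((a : ℂ) - (z + (σ : ℂ) ^ 2 * f z))⁻¹ := by
  classical
  have him := fun z hz => hf.im_nonneg (z := z) hz
  obtain ⟨κ, _, q, x, hq, hq1, h⟩ := hf
  let H : Matrix (Option κ) (Option κ) ℂ := Matrix.of fun i j => match i, j with
    | none, none => (a : ℂ)
    | none, some j => ((σ * √(q j) : ℝ) : ℂ)
    | some i, none => ((σ * √(q i) : ℝ) : ℂ)
    | some i, some j => if i = j then (x i : ℂ) else 0
  have hH : H.IsHermitian := by
    ext i j
    rcases i with _ | i <;> rcases j with _ | j <;>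
      simp only [H, Matrix.conjTranspose_apply, Matrix.of_apply, RCLike.star_def,
        Complex.conj_ofReal]
    by_cases hij : i = j
    · subst hij; simp
    · simp [hij, Ne.symm hij]
  let u := hH.eigenvectorBasis
  have hexp : ∀ v : EuclideanSpace ℂ (Option κ),
      ∑ k, (v.ofLp ⬝ᵥ star (u k).ofLp) * (u k).ofLp none = v.ofLp none := by
    intro v
    have := congrArg (fun y : EuclideanSpace ℂ (Option κ) => y.ofLp none) (u.sum_repr' v)
    simpa [EuclideanSpace.inner_eq_star_dotProduct] using this
  have heig : ∀ (v : Option κ → ℂ) k,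
      (H.mulVec v) ⬝ᵥ star (u k).ofLp = (hH.eigenvalues k : ℂ) * (v ⬝ᵥ star (u k).ofLp) := by
    intro v k
    have h1 : H.mulVec (u k).ofLp = (hH.eigenvalues k : ℂ) • (u k).ofLp := by
      have := hH.mulVec_eigenvectorBasis k
      simpa using this
    have h2 : Matrix.vecMul (star (u k).ofLp) H = (hH.eigenvalues k : ℂ) • star (u k).ofLp := by
      have := congrArg star h1
      rw [Matrix.star_mulVec, hH.eq] at this
      rw [this]
      simp
    rw [dotProduct_comm, Matrix.dotProduct_mulVec, h2, smul_dotProduct, smul_eq_mul,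
      dotProduct_comm]
  refine ⟨Option κ, inferInstance, fun k => ‖(u k).ofLp none‖ ^ 2, hH.eigenvalues,
    fun k => by positivity, ?_, fun z hz => ?_⟩
  · have := hexp (EuclideanSpace.single none 1)
    simp only [PiLp.ofLp_single, single_dotProduct, Pi.star_apply, RCLike.star_def, one_mul,
      Pi.single_eq_same, Complex.conj_mul'] at this
    exact_mod_cast this
  · have hne : (a : ℂ) - (z + (σ : ℂ) ^ 2 * f z) ≠ 0 := by
      refine ofReal_sub_ne_zero ?_ a
      rw [Complex.add_im, ← Complex.ofReal_pow, Complex.im_ofReal_mul]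
      have := him z hz
      positivity
    set c := ((a : ℂ) - (z + (σ : ℂ) ^ 2 * f z))⁻¹ with hc
    -- `w` is the first column of `(H - z)⁻¹`.
    let w : Option κ → ℂ := fun i => match i with
      | none => c
      | some j => -(((σ * √(q j) : ℝ) : ℂ) * c * ((x j : ℂ) - z)⁻¹)
    have hw : H.mulVec w = z • w + Pi.single none 1 := by
      ext i
      rcases i with _ | i
      · have hsum : ∑ j, ((σ * √(q j) : ℝ) : ℂ) * (-(((σ * √(q j) : ℝ) : ℂ) * c *
            ((x j : ℂ) - z)⁻¹)) = -((σ : ℂ) ^ 2 * f z * c) := by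
          rw [h z hz, weightedResolvent, Finset.mul_sum, Finset.sum_mul, ← Finset.sum_neg_distrib]
          refine Finset.sum_congr rfl fun j _ => ?_
          have : ((√(q j) : ℝ) : ℂ) * (√(q j) : ℝ) = q j := by
            rw [← Complex.ofReal_mul, Real.mul_self_sqrt (hq j)]
          rw [← this]
          push_cast
          ring
        have h1 : ((a : ℂ) - (z + (σ : ℂ) ^ 2 * f z)) * c = 1 := mul_inv_cancel₀ hne
        simp only [Matrix.mulVec, dotProduct, Fintype.sum_option, H, Matrix.of_apply, w,
          Pi.add_apply, Pi.smul_apply, smul_eq_mul, Pi.single_eq_same]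
        rw [hsum]
        linear_combination h1
      · have h1 : ((x i : ℂ) - z) * ((x i : ℂ) - z)⁻¹ = 1 :=
          mul_inv_cancel₀ (ofReal_sub_ne_zero hz _)
        simp only [Matrix.mulVec, dotProduct, Fintype.sum_option, H, Matrix.of_apply, w,
          Pi.add_apply, Pi.smul_apply, smul_eq_mul, ite_mul, zero_mul, Finset.sum_ite_eq,
          Finset.mem_univ, if_true]
        rw [Pi.single_eq_of_ne (by simp)]
        linear_combination (-((σ * √(q i) : ℝ) : ℂ) * c) * h1
    have hcoef : ∀ k, w ⬝ᵥ star (u k).ofLp =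
        ((hH.eigenvalues k : ℂ) - z)⁻¹ * star ((u k).ofLp none) := by
      intro k
      have h1 := heig w k
      rw [hw, add_dotProduct, smul_dotProduct, single_dotProduct, Pi.star_apply] at h1
      rw [inv_mul_eq_div, eq_div_iff (ofReal_sub_ne_zero hz _)]
      simp only [smul_eq_mul, one_mul] at h1
      linear_combination -h1
    have := hexp (WithLp.toLp 2 w)
    simp only [hcoef] at this
    change _ = c at this
    change c = _
    rw [← this, weightedResolvent]
    refine Finset.sum_congr rfl fun k _ => ?_
    rw [mul_assoc, RCLike.star_def, Complex.conj_mul', mul_comm]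
    push_cast
    rfl

theorem IsAtomicResolvent.mixture {ι : Type} [Fintype ι] {p : ι → ℝ} (hp : ∀ i, 0 ≤ p i)
    (hp1 : ∑ i, p i = 1) {f : ι → ℂ → ℂ} (hf : ∀ i, IsAtomicResolvent (f i)) :
    IsAtomicResolvent fun z => ∑ i, (p i : ℂ) * f i z := by
  choose κ hκ q x hq hq1 h using hf
  refine ⟨(i : ι) × κ i, inferInstance, fun k => p k.1 * q k.1 k.2, fun k => x k.1 k.2,
    fun k => mul_nonneg (hp _) (hq _ _), ?_, fun z hz => ?_⟩
  · simp [Fintype.sum_sigma, ← Finset.mul_sum, hq1, hp1]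
  · simp only [weightedResolvent, Fintype.sum_sigma, h _ z hz, Finset.mul_sum]
    simp [mul_assoc]

theorem IsAtomicResolvent.exists_measure {f : ℂ → ℂ} (hf : IsAtomicResolvent f) :
    ∃ μ : Measure ℝ, IsProbabilityMeasure μ ∧ ∀ z : ℂ, 0 < z.im → resolventTransform μ z = f z := by
  obtain ⟨κ, _, q, x, hq, hq1, h⟩ := hf
  refine ⟨∑ k, ENNReal.ofReal (q k) • Measure.dirac (x k), ⟨?_⟩, fun z hz => ?_⟩
  · simp [← ENNReal.ofReal_sum_of_nonneg fun k _ => hq k, hq1]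
  · rw [h z hz, resolventTransform_eq_integral, integral_finsetSum_measure]
    · simp [weightedResolvent, hq]
    · intro k _
      exact (integrable_inv_ofReal_sub _ hz).smul_measure ENNReal.ofReal_ne_top

theorem isTightMeasureSet_of_lintegral_sq_le {S : Set (Measure ℝ)} {C : ℝ}
    (h : ∀ μ ∈ S, ∫⁻ x : ℝ, ENNReal.ofReal (x ^ 2) ∂μ ≤ ENNReal.ofReal C) :
    IsTightMeasureSet S := by
  rw [isTightMeasureSet_iff_exists_isCompact_measure_compl_le]
  intro ε hε
  have hlim : Tendsto (fun R : ℝ => ENNReal.ofReal (C / R ^ 2)) atTop (𝓝 0) := by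
    rw [← ENNReal.ofReal_zero]
    exact ENNReal.tendsto_ofReal (tendsto_const_nhds.div_atTop (tendsto_pow_atTop two_ne_zero))
  obtain ⟨R, hR, hR0⟩ := ((hlim.eventually_lt_const hε).and (eventually_gt_atTop 0)).exists
  refine ⟨Icc (-R) R, isCompact_Icc, fun μ hμ => le_trans ?_ hR.le⟩
  have hsub : (Icc (-R) R)ᶜ ⊆ {x : ℝ | ENNReal.ofReal (R ^ 2) ≤ ENNReal.ofReal (x ^ 2)} := by
    intro x hx
    refine ENNReal.ofReal_le_ofReal (sq_le_sq.2 ?_)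
    rw [abs_of_pos hR0]
    by_contra hlt
    exact hx (abs_le.1 (not_le.1 hlt).le)
  rw [ENNReal.ofReal_div_of_pos (by positivity)]
  calc μ (Icc (-R) R)ᶜ ≤ μ {x : ℝ | ENNReal.ofReal (R ^ 2) ≤ ENNReal.ofReal (x ^ 2)} :=
        measure_mono hsub
    _ ≤ (∫⁻ x : ℝ, ENNReal.ofReal (x ^ 2) ∂μ) / ENNReal.ofReal (R ^ 2) :=
        meas_ge_le_lintegral_div (by fun_prop) (by simpa using hR0.ne') ENNReal.ofReal_ne_top
    _ ≤ _ := by gcongr; exact h μ hμ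

theorem tendsto_resolventTransform {β : Type*} {F : Filter β} {μs : β → ProbabilityMeasure ℝ}
    {μ : ProbabilityMeasure ℝ} (h : Tendsto μs F (𝓝 μ)) {z : ℂ} (hz : 0 < z.im) :
    Tendsto (fun b => resolventTransform (μs b : Measure ℝ) z) F
      (𝓝 (resolventTransform (μ : Measure ℝ) z)) := by
  simp only [resolventTransform_eq_integral]
  exact (ProbabilityMeasure.tendsto_iff_forall_integral_rclike_tendsto ℂ).1 h
    (BoundedContinuousFunction.ofNormedAddCommGroup (fun x : ℝ => ((x : ℂ) - z)⁻¹)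
      (continuous_inv_ofReal_sub hz) z.im⁻¹ (norm_inv_ofReal_sub_le hz))

theorem add_sq_mul_im (σ : ℝ) (z t : ℂ) : (z + (σ : ℂ) ^ 2 * t).im = z.im + σ ^ 2 * t.im := by
  rw [Complex.add_im, ← Complex.ofReal_pow, Complex.im_ofReal_mul]

theorem le_add_sq_mul_im (σ : ℝ) {z t : ℂ} (ht : 0 ≤ t.im) :
    z.im ≤ (z + (σ : ℂ) ^ 2 * t).im := by
  rw [add_sq_mul_im]
  have := mul_nonneg (sq_nonneg σ) ht
  linarith

theorem differentiableAt_weightedResolvent {ι : Type*} [Fintype ι] (p lam : ι → ℝ) {w : ℂ}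
    (hw : 0 < w.im) : DifferentiableAt ℂ (weightedResolvent p lam) w := by
  unfold weightedResolvent
  refine DifferentiableAt.fun_sum fun i _ => ?_
  exact ((differentiableAt_const _).sub differentiableAt_id).inv (ofReal_sub_ne_zero hw _)
    |>.const_mul _

theorem norm_weightedResolvent_sub_le {ι : Type*} [Fintype ι] {p : ι → ℝ} (hp : ∀ i, 0 ≤ p i)
    (hp1 : ∑ i, p i = 1) (lam : ι → ℝ) {y : ℝ} (hy : 0 < y) {w w' : ℂ} (hw : y ≤ w.im)
    (hw' : y ≤ w'.im) :
    ‖weightedResolvent p lam w - weightedResolvent p lam w'‖ ≤ y⁻¹ ^ 2 * ‖w - w'‖ := by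
  have hterm : ∀ i, ‖(p i : ℂ) * ((lam i : ℂ) - w)⁻¹ - (p i : ℂ) * ((lam i : ℂ) - w')⁻¹‖ ≤
      p i * (y⁻¹ ^ 2 * ‖w - w'‖) := by
    intro i
    have h1 := ofReal_sub_ne_zero (hy.trans_le hw) (lam i)
    have h2 := ofReal_sub_ne_zero (hy.trans_le hw') (lam i)
    have h3 : ‖((lam i : ℂ) - w)⁻¹‖ ≤ y⁻¹ :=
      (norm_inv_ofReal_sub_le (hy.trans_le hw) _).trans (inv_anti₀ hy hw)
    have h4 : ‖((lam i : ℂ) - w')⁻¹‖ ≤ y⁻¹ :=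
      (norm_inv_ofReal_sub_le (hy.trans_le hw') _).trans (inv_anti₀ hy hw')
    rw [show (p i : ℂ) * ((lam i : ℂ) - w)⁻¹ - (p i : ℂ) * ((lam i : ℂ) - w')⁻¹ =
      (p i : ℂ) * (((lam i : ℂ) - w)⁻¹ * ((lam i : ℂ) - w')⁻¹ * (w - w')) by field_simp; ring]
    rw [norm_mul, norm_mul, norm_mul, Complex.norm_of_nonneg (hp i), sq]
    have := hp i
    gcongr
  unfold weightedResolvent
  rw [← Finset.sum_sub_distrib]
  refine (norm_sum_le _ _).trans ((Finset.sum_le_sum fun i _ => hterm i).trans_eq ?_)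
  rw [← Finset.sum_mul, hp1, one_mul]

/-- The fixed-point iteration `s₀(z) = -1 / z`, `sₙ₊₁(z) = ∑ᵢ pᵢ / (λᵢ - z - σ² sₙ(z))`: the averaged
resolvent at the root of a weighted tree of depth `n`. -/
noncomputable def treeResolvent {ι : Type*} [Fintype ι] (p lam : ι → ℝ) (σ : ℝ) : ℕ → ℂ → ℂ
  | 0 => fun z => (((0 : ℝ) : ℂ) - z)⁻¹
  | n + 1 => fun z => weightedResolvent p lam (z + (σ : ℂ) ^ 2 * treeResolvent p lam σ n z)

section

variable {ι : Type} [Fintype ι] {p : ι → ℝ}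

theorem isAtomicResolvent_treeResolvent (hp : ∀ i, 0 ≤ p i) (hp1 : ∑ i, p i = 1) (lam : ι → ℝ)
    (σ : ℝ) (n : ℕ) : IsAtomicResolvent (treeResolvent p lam σ n) := by
  induction n with
  | zero => exact ⟨Unit, inferInstance, fun _ => 1, fun _ => 0, by simp, by simp,
      fun z _ => by simp [treeResolvent, weightedResolvent]⟩
  | succ n ih =>
    exact IsAtomicResolvent.mixture hp hp1 fun i => isAtomicResolvent_bordered ih (lam i) σ

/-- For `Im z > σ` the iteration is a contraction with factor `(σ / Im z)²`. -/
theorem tendsto_treeResolvent_succ_sub (hp : ∀ i, 0 ≤ p i) (hp1 : ∑ i, p i = 1) (lam : ι → ℝ)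
    {σ : ℝ} (hσ : 0 < σ) {z : ℂ} (hz : σ < z.im) :
    Tendsto (fun n => treeResolvent p lam σ (n + 1) z - treeResolvent p lam σ n z) atTop
      (𝓝 0) := by
  have hz0 : 0 < z.im := hσ.trans hz
  have him : ∀ n, 0 ≤ (treeResolvent p lam σ n z).im := fun n =>
    (isAtomicResolvent_treeResolvent hp hp1 lam σ n).im_nonneg hz0
  have hq : (z.im⁻¹ * σ) ^ 2 < 1 := by
    have : z.im⁻¹ * σ < 1 := by rw [inv_mul_lt_one₀ hz0]; exact hz
    have h0 : 0 ≤ z.im⁻¹ * σ := by positivity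
    nlinarith
  have hgeo : ∀ n, ‖treeResolvent p lam σ (n + 1) z - treeResolvent p lam σ n z‖ ≤
      ((z.im⁻¹ * σ) ^ 2) ^ n * ‖treeResolvent p lam σ 1 z - treeResolvent p lam σ 0 z‖ := by
    intro n
    induction n with
    | zero => simp
    | succ n ih =>
      have h1 := norm_weightedResolvent_sub_le hp hp1 lam hz0 (le_add_sq_mul_im σ (him (n + 1)))
        (le_add_sq_mul_im σ (him n))
      rw [add_sub_add_left_eq_sub, ← mul_sub, norm_mul, norm_pow,
        Complex.norm_of_nonneg hσ.le] at h1
      calc _ ≤ _ := h1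
        _ = (z.im⁻¹ * σ) ^ 2 * ‖treeResolvent p lam σ (n + 1) z - treeResolvent p lam σ n z‖ := by
          ring
        _ ≤ (z.im⁻¹ * σ) ^ 2 * (((z.im⁻¹ * σ) ^ 2) ^ n *
            ‖treeResolvent p lam σ 1 z - treeResolvent p lam σ 0 z‖) := by gcongr
        _ = _ := by ring
  refine squeeze_zero_norm hgeo ?_
  simpa using (tendsto_pow_atTop_nhds_zero_of_lt_one (by positivity) hq).mul_const
    ‖treeResolvent p lam σ 1 z - treeResolvent p lam σ 0 z‖

/-- Existence of the free convolution. The measures with Stieltjes transforms `treeResolvent n` have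
bounded second moments, so they have a weak cluster point by Prokhorov's theorem. It solves the
fixed-point equation for `Im z > σ`, where consecutive iterates come together, hence on the whole
upper half-plane by the identity theorem. -/
theorem exists_subordinated_measure (hp : ∀ i, 0 ≤ p i) (hp1 : ∑ i, p i = 1)
    (lam : ι → ℝ) {σ : ℝ} (hσ : 0 < σ) :
    ∃ μ : Measure ℝ, IsProbabilityMeasure μ ∧ IsSubordinated p lam σ μ := by
  choose μ hprob hμ using fun n =>
    (isAtomicResolvent_treeResolvent hp hp1 lam σ n).exists_measure
  obtain ⟨A, hA⟩ : ∃ A, ∀ i, |lam i| ≤ A :=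
    ⟨∑ i, |lam i|, fun i => Finset.single_le_sum (f := fun i => |lam i|)
      (fun j _ => abs_nonneg _) (Finset.mem_univ i)⟩
  let P : ℕ → ProbabilityMeasure ℝ := fun n => ⟨μ (n + 1), hprob _⟩
  have hP : ∀ n z, 0 < z.im →
      resolventTransform (P n : Measure ℝ) z = treeResolvent p lam σ (n + 1) z :=
    fun n z hz => hμ (n + 1) z hz
  have htight : IsTightMeasureSet {((ρ : ProbabilityMeasure ℝ) : Measure ℝ) | ρ ∈ range P} := by
    refine isTightMeasureSet_of_lintegral_sq_le (C := (A + σ ^ 2) ^ 2 + σ ^ 2) ?_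
    rintro _ ⟨_, ⟨n, rfl⟩, rfl⟩
    have := hprob n
    refine lintegral_sq_le_of_subordination hp hp1 hA (P n : Measure ℝ) (μ n) fun z hz => ?_
    rw [hP n z hz, hμ n z hz]
    rfl
  -- A cluster point is taken along an ultrafilter on `ℕ`, which avoids extracting a subsequence.
  obtain ⟨ρ, -, hρ⟩ := (isCompact_closure_of_isTightMeasureSet htight).ultrafilter_le_nhds
    ((hyperfilter ℕ).map P) (by
      rw [le_principal_iff]
      exact mem_map.2 (univ_mem' fun n => subset_closure (mem_range_self n)))
  have hlim : ∀ z : ℂ, 0 < z.im → Tendsto (fun n => treeResolvent p lam σ (n + 1) z)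
      (hyperfilter ℕ) (𝓝 (resolventTransform (ρ : Measure ℝ) z)) := by
    intro z hz
    exact (tendsto_resolventTransform (F := (hyperfilter ℕ : Filter ℕ)) hρ hz).congr
      fun n => hP n z hz
  have him : ∀ z : ℂ, 0 < z.im →
      0 < (z + (σ : ℂ) ^ 2 * resolventTransform (ρ : Measure ℝ) z).im := fun z hz =>
    hz.trans_le (le_add_sq_mul_im σ (resolventTransform_im_nonneg _ hz))
  have hlarge : ∀ z : ℂ, σ < z.im → resolventTransform (ρ : Measure ℝ) z =
      weightedResolvent p lam (z + (σ : ℂ) ^ 2 * resolventTransform (ρ : Measure ℝ) z) := by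
    intro z hz
    have hz0 := hσ.trans hz
    have h1 : Tendsto (fun n => treeResolvent p lam σ (n + 1 + 1) z) (hyperfilter ℕ)
        (𝓝 (resolventTransform (ρ : Measure ℝ) z)) := by
      have := ((tendsto_treeResolvent_succ_sub hp hp1 lam hσ hz).comp
        (tendsto_add_atTop_nat 1)).mono_left Nat.hyperfilter_le_atTop
      simpa using this.add (hlim z hz0)
    have h2 : Tendsto (fun n => treeResolvent p lam σ (n + 1 + 1) z) (hyperfilter ℕ)
        (𝓝 (weightedResolvent p lam
          (z + (σ : ℂ) ^ 2 * resolventTransform (ρ : Measure ℝ) z))) :=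
      (differentiableAt_weightedResolvent p lam (him z hz0)).continuousAt.tendsto.comp
        (((hlim z hz0).const_mul _).const_add z)
    exact tendsto_nhds_unique h1 h2
  refine ⟨ρ, inferInstance, fun z hz => ?_⟩
  have hopen : IsOpen {z : ℂ | 0 < z.im} := isOpen_lt continuous_const Complex.continuous_im
  have hd : DifferentiableOn ℂ (resolventTransform (ρ : Measure ℝ)) {z : ℂ | 0 < z.im} :=
    fun z hz => (differentiableAt_resolventTransform _ hz).differentiableWithinAt
  have hd' : DifferentiableOn ℂ (fun z => weightedResolvent p lam
      (z + (σ : ℂ) ^ 2 * resolventTransform (ρ : Measure ℝ) z)) {z : ℂ | 0 < z.im} := by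
    intro z hz
    have hin : DifferentiableAt ℂ
        (fun z => z + (σ : ℂ) ^ 2 * resolventTransform (ρ : Measure ℝ) z) z :=
      differentiableAt_id.add ((differentiableAt_resolventTransform _ hz).const_mul _)
    exact ((differentiableAt_weightedResolvent p lam (him z hz)).comp z hin).differentiableWithinAt
  refine (hd.analyticOnNhd hopen).eqOn_of_preconnected_of_eventuallyEq (hd'.analyticOnNhd hopen)
    (convex_halfSpace_im_gt 0).isPreconnected (z₀ := ((σ + 1 : ℝ) : ℂ) * Complex.I)
    (by simp; linarith) ?_ hz
  filter_upwards [(isOpen_lt continuous_const Complex.continuous_im).mem_nhds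
    (show σ < (((σ + 1 : ℝ) : ℂ) * Complex.I).im by simp)] with z hz using hlarge z hz

end

/-! ### Boundary value of the Stieltjes transform at zero -/

section

variable {ι : Type*} [Fintype ι] {p lam : ι → ℝ} {σ : ℝ} {μ : Measure ℝ} [IsProbabilityMeasure μ]

theorem im_le_subord_im (σ : ℝ) (μ : Measure ℝ) [IsProbabilityMeasure μ] {z : ℂ} (hz : 0 < z.im) :
    z.im ≤ (subord σ μ z).im :=
  le_add_sq_mul_im σ (resolventTransform_im_nonneg μ hz)

theorem subord_im_pos (σ : ℝ) (μ : Measure ℝ) [IsProbabilityMeasure μ] {z : ℂ} (hz : 0 < z.im) :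
    0 < (subord σ μ z).im :=
  hz.trans_le (im_le_subord_im σ μ hz)

/-- Taking imaginary parts in the fixed-point equation, with `w = z + σ² s(z)`:
`Im w = Im z + σ² Im w ∑ᵢ pᵢ / |λᵢ - w|²`. -/
theorem IsSubordinated.sum_norm_sq_le (hμ : IsSubordinated p lam σ μ) {z : ℂ} (hz : 0 < z.im) :
    σ ^ 2 * ∑ i, p i * ‖((lam i : ℂ) - subord σ μ z)⁻¹‖ ^ 2 ≤ 1 := by
  have hw := subord_im_pos σ μ hz
  have h1 : (subord σ μ z).im = z.im + σ ^ 2 * (resolventTransform μ z).im := add_sq_mul_im σ z _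
  have h2 : (resolventTransform μ z).im =
      (subord σ μ z).im * ∑ i, p i * ‖((lam i : ℂ) - subord σ μ z)⁻¹‖ ^ 2 := by
    conv_lhs => rw [hμ z hz]
    exact weightedResolvent_im p lam _
  rw [h2] at h1
  by_contra! h
  nlinarith

theorem IsSubordinated.norm_le (hμ : IsSubordinated p lam σ μ) (hp : ∀ i, 0 ≤ p i)
    (hp1 : ∑ i, p i = 1) (hσ : 0 < σ) {z : ℂ} (hz : 0 < z.im) :
    ‖resolventTransform μ z‖ ≤ σ⁻¹ := by
  have h1 : ‖resolventTransform μ z‖ ≤ ∑ i, p i * ‖((lam i : ℂ) - subord σ μ z)⁻¹‖ := by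
    rw [hμ z hz, weightedResolvent]
    refine (norm_sum_le _ _).trans_eq (Finset.sum_congr rfl fun i _ => ?_)
    rw [norm_mul, Complex.norm_of_nonneg (hp i)]
    rfl
  have h2 : ∑ i, p i * (2 * σ * ‖((lam i : ℂ) - subord σ μ z)⁻¹‖) ≤
      ∑ i, p i * (1 + σ ^ 2 * ‖((lam i : ℂ) - subord σ μ z)⁻¹‖ ^ 2) :=
    Finset.sum_le_sum fun i _ => mul_le_mul_of_nonneg_left
      (by nlinarith [sq_nonneg (1 - σ * ‖((lam i : ℂ) - subord σ μ z)⁻¹‖)]) (hp i)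
  have h3 : ∑ i, p i * (2 * σ * ‖((lam i : ℂ) - subord σ μ z)⁻¹‖) =
      2 * σ * ∑ i, p i * ‖((lam i : ℂ) - subord σ μ z)⁻¹‖ := by
    rw [Finset.mul_sum]; exact Finset.sum_congr rfl fun i _ => by ring
  have h4 : ∑ i, p i * (1 + σ ^ 2 * ‖((lam i : ℂ) - subord σ μ z)⁻¹‖ ^ 2) =
      1 + σ ^ 2 * ∑ i, p i * ‖((lam i : ℂ) - subord σ μ z)⁻¹‖ ^ 2 := by
    conv_rhs => rw [← hp1]
    rw [Finset.mul_sum, ← Finset.sum_add_distrib]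
    exact Finset.sum_congr rfl fun i _ => by ring
  have h5 := hμ.sum_norm_sq_le hz
  rw [← one_div, le_div_iff₀ hσ]
  nlinarith

/-- The difference of the fixed-point equations at `z` and at the real solution `g`, with
`w = z + σ² s(z)`: `(w - σ² g) (1 - σ² ∑ᵢ pᵢ / ((λᵢ - w) (λᵢ - σ² g))) = z`. -/
theorem IsSubordinated.subord_sub_mul_eq (hμ : IsSubordinated p lam σ μ) {g : ℝ}
    (hg : ∀ i, 0 < lam i - σ ^ 2 * g) (hfix : g = ∑ i, p i * (lam i - σ ^ 2 * g)⁻¹) {z : ℂ}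
    (hz : 0 < z.im) :
    (subord σ μ z - (σ ^ 2 * g : ℝ)) * (1 - (σ : ℂ) ^ 2 * ∑ i, (p i : ℂ) *
      (((lam i : ℂ) - subord σ μ z)⁻¹ * ((lam i - σ ^ 2 * g)⁻¹ : ℝ))) = z := by
  have hterm : ∀ i, (p i : ℂ) * ((lam i : ℂ) - subord σ μ z)⁻¹ -
      (p i : ℂ) * ((lam i - σ ^ 2 * g)⁻¹ : ℝ) = (subord σ μ z - (σ ^ 2 * g : ℝ)) *
        ((p i : ℂ) * (((lam i : ℂ) - subord σ μ z)⁻¹ * ((lam i - σ ^ 2 * g)⁻¹ : ℝ))) := by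
    intro i
    have h1 := ofReal_sub_ne_zero (subord_im_pos σ μ hz) (lam i)
    have h2 : ((lam i : ℂ) - (σ : ℂ) ^ 2 * (g : ℂ)) ≠ 0 := by exact_mod_cast (hg i).ne'
    push_cast
    field_simp
    ring
  have hs : resolventTransform μ z = weightedResolvent p lam (subord σ μ z) := hμ z hz
  have hfix' : (g : ℂ) = ∑ i, (p i : ℂ) * ((lam i - σ ^ 2 * g)⁻¹ : ℝ) := by
    exact_mod_cast hfix
  have hdiff : resolventTransform μ z - g = (subord σ μ z - (σ ^ 2 * g : ℝ)) *
      ∑ i, (p i : ℂ) * (((lam i : ℂ) - subord σ μ z)⁻¹ * ((lam i - σ ^ 2 * g)⁻¹ : ℝ)) := by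
    rw [hs, Finset.mul_sum]
    conv_lhs => rw [hfix']
    rw [weightedResolvent, ← Finset.sum_sub_distrib]
    exact Finset.sum_congr rfl fun i _ => hterm i
  have hw : subord σ μ z = z + (σ : ℂ) ^ 2 * resolventTransform μ z := rfl
  have : ((σ ^ 2 * g : ℝ) : ℂ) = (σ : ℂ) ^ 2 * g := by push_cast; rfl
  linear_combination hw - this + (σ : ℂ) ^ 2 * hdiff

theorem re_mul_ofReal_eq (a : ℂ) (b : ℝ) :
    (a * b).re = (‖a‖ ^ 2 + b ^ 2 - ‖a - b‖ ^ 2) / 2 := by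
  rw [← Complex.normSq_eq_norm_sq, ← Complex.normSq_eq_norm_sq, Complex.normSq_apply,
    Complex.normSq_apply]
  simp
  ring

/-- Quantitative stability of a real solution `g` with `σ² ∑ᵢ pᵢ bᵢ² ≤ 1`, `bᵢ = 1 / (λᵢ - σ² g)`. With
`w = z + σ² s(z)` and `aᵢ = 1 / (λᵢ - w)`, also `σ² ∑ᵢ pᵢ |aᵢ|² ≤ 1`, so
`Re (1 - σ² ∑ᵢ pᵢ aᵢ bᵢ) ≥ σ²/2 ∑ᵢ pᵢ |aᵢ - bᵢ|²`, and `aᵢ - bᵢ = (w - σ² g) aᵢ bᵢ`. Together with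
`subord_sub_mul_eq` this bounds `|w - σ² g|³` by a multiple of `|z|`; the cube allows for the critical
case, where `0` is an edge of the support of `μ`. -/
theorem IsSubordinated.norm_subord_sub_pow_le (hμ : IsSubordinated p lam σ μ)
    (hp : ∀ i, 0 ≤ p i) {g : ℝ} (hg : ∀ i, 0 < lam i - σ ^ 2 * g)
    (hfix : g = ∑ i, p i * (lam i - σ ^ 2 * g)⁻¹)
    (hstab : σ ^ 2 * ∑ i, p i * (lam i - σ ^ 2 * g)⁻¹ ^ 2 ≤ 1) {z : ℂ} (hz : 0 < z.im) (j : ι) :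
    ‖subord σ μ z - (σ ^ 2 * g : ℝ)‖ ^ 3 * (σ ^ 2 / 2 * (p j *
      (‖((lam j : ℂ) - subord σ μ z)⁻¹‖ ^ 2 * (lam j - σ ^ 2 * g)⁻¹ ^ 2))) ≤ ‖z‖ := by
  set w := subord σ μ z with hw
  set a : ι → ℂ := fun i => ((lam i : ℂ) - w)⁻¹ with ha
  set b : ι → ℝ := fun i => (lam i - σ ^ 2 * g)⁻¹ with hb
  set d := ‖w - (σ ^ 2 * g : ℝ)‖ with hd
  have h1 : σ ^ 2 * ∑ i, p i * ‖a i‖ ^ 2 ≤ 1 := hμ.sum_norm_sq_le hz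
  have hab : ∀ i, ‖a i - b i‖ ^ 2 = d ^ 2 * (‖a i‖ ^ 2 * b i ^ 2) := by
    intro i
    have h1 : (lam i : ℂ) - w ≠ 0 := ofReal_sub_ne_zero (subord_im_pos σ μ hz) (lam i)
    have h2 : ((lam i : ℂ) - (σ : ℂ) ^ 2 * (g : ℂ)) ≠ 0 := by exact_mod_cast (hg i).ne'
    have : a i - b i = (w - (σ ^ 2 * g : ℝ)) * (a i * b i) := by
      simp only [ha, hb]
      push_cast
      field_simp
      ring
    rw [this, norm_mul, norm_mul, Complex.norm_real, mul_pow, mul_pow, Real.norm_eq_abs, sq_abs]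
  have hre : (1 - (σ : ℂ) ^ 2 * ∑ i, (p i : ℂ) * (a i * b i)).re =
      1 - σ ^ 2 * ∑ i, p i * ((‖a i‖ ^ 2 + b i ^ 2 - ‖a i - b i‖ ^ 2) / 2) := by
    simp only [Complex.sub_re, Complex.one_re, ← Complex.ofReal_pow, Complex.re_ofReal_mul,
      Complex.re_sum, re_mul_ofReal_eq]
  have hsplit : ∑ i, p i * ((‖a i‖ ^ 2 + b i ^ 2 - ‖a i - b i‖ ^ 2) / 2) =
      (∑ i, p i * ‖a i‖ ^ 2 + ∑ i, p i * b i ^ 2 - ∑ i, p i * ‖a i - b i‖ ^ 2) / 2 := by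
    rw [← Finset.sum_add_distrib, ← Finset.sum_sub_distrib, Finset.sum_div]
    exact Finset.sum_congr rfl fun i _ => by ring
  have hsingle : p j * (d ^ 2 * (‖a j‖ ^ 2 * b j ^ 2)) ≤ ∑ i, p i * ‖a i - b i‖ ^ 2 := by
    rw [← hab]
    exact Finset.single_le_sum (f := fun i => p i * ‖a i - b i‖ ^ 2)
      (fun i _ => mul_nonneg (hp i) (by positivity)) (Finset.mem_univ j)
  have hlow : σ ^ 2 / 2 * (p j * (d ^ 2 * (‖a j‖ ^ 2 * b j ^ 2))) ≤
      ‖1 - (σ : ℂ) ^ 2 * ∑ i, (p i : ℂ) * (a i * b i)‖ := by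
    refine le_trans ?_ (Complex.re_le_norm _)
    rw [hre, hsplit]
    have := mul_le_mul_of_nonneg_left hsingle (sq_nonneg σ)
    have h2 : σ ^ 2 * ∑ i, p i * b i ^ 2 ≤ 1 := hstab
    linarith
  calc d ^ 3 * (σ ^ 2 / 2 * (p j * (‖a j‖ ^ 2 * b j ^ 2)))
      = d * (σ ^ 2 / 2 * (p j * (d ^ 2 * (‖a j‖ ^ 2 * b j ^ 2)))) := by ring
    _ ≤ d * ‖1 - (σ : ℂ) ^ 2 * ∑ i, (p i : ℂ) * (a i * b i)‖ := by gcongr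
    _ = ‖z‖ := by rw [hd, ← norm_mul, hμ.subord_sub_mul_eq hg hfix hz]

/-- Boundary value of the subordination function at `0`. -/
theorem IsSubordinated.tendsto_subord (hμ : IsSubordinated p lam σ μ) (hσ : 0 < σ) [Nonempty ι]
    (hp : ∀ i, 0 < p i) (hp1 : ∑ i, p i = 1) {g : ℝ} (hg : ∀ i, 0 < lam i - σ ^ 2 * g)
    (hfix : g = ∑ i, p i * (lam i - σ ^ 2 * g)⁻¹)
    (hstab : σ ^ 2 * ∑ i, p i * (lam i - σ ^ 2 * g)⁻¹ ^ 2 ≤ 1) :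
    Tendsto (fun η : ℝ => subord σ μ (η * Complex.I)) (𝓝[>] 0) (𝓝 ((σ ^ 2 * g : ℝ) : ℂ)) := by
  obtain ⟨j⟩ := ‹Nonempty ι›
  set B : ℝ := (|lam j| + 1 + σ)⁻¹ with hB
  have hB0 : 0 < B := by positivity
  set K : ℝ := σ ^ 2 / 2 * (p j * (B ^ 2 * (lam j - σ ^ 2 * g)⁻¹ ^ 2)) with hK
  have hK0 : 0 < K := by
    have := hp j
    have := hg j
    positivity
  have hbound : ∀ᶠ η : ℝ in 𝓝[>] 0,
      ‖subord σ μ (η * Complex.I) - (σ ^ 2 * g : ℝ)‖ ^ 3 ≤ η / K := by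
    filter_upwards [Ioc_mem_nhdsGT (zero_lt_one (α := ℝ))] with η hη
    have hη0 : 0 < η := hη.1
    have hz : 0 < ((η : ℂ) * Complex.I).im := by simpa using hη0
    have hnz : ‖(η : ℂ) * Complex.I‖ = η := by simp [abs_of_pos hη0]
    have hw : ‖(lam j : ℂ) - subord σ μ (η * Complex.I)‖ ≤ |lam j| + 1 + σ := by
      have h1 := hμ.norm_le (fun i => (hp i).le) hp1 hσ hz
      have h2 : ‖subord σ μ (η * Complex.I)‖ ≤ 1 + σ := by
        refine (norm_add_le _ _).trans (add_le_add (hnz.trans_le hη.2) ?_)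
        rw [norm_mul, norm_pow, Complex.norm_of_nonneg hσ.le]
        calc σ ^ 2 * ‖resolventTransform μ (η * Complex.I)‖ ≤ σ ^ 2 * σ⁻¹ := by gcongr
          _ = σ := by field_simp
      refine (norm_sub_le _ _).trans ?_
      rw [Complex.norm_real, Real.norm_eq_abs]
      linarith
    have hBle : B ≤ ‖((lam j : ℂ) - subord σ μ (η * Complex.I))⁻¹‖ := by
      rw [norm_inv]
      exact inv_anti₀ (norm_pos_iff.2 (ofReal_sub_ne_zero (subord_im_pos σ μ hz) _)) hw
    have h := hμ.norm_subord_sub_pow_le (fun i => (hp i).le) hg hfix hstab hz j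
    rw [hnz] at h
    rw [le_div_iff₀ hK0]
    refine le_trans ?_ h
    have := (hp j).le
    rw [hK]
    gcongr
  rw [tendsto_iff_norm_sub_tendsto_zero]
  have hcube : Tendsto (fun η : ℝ => ‖subord σ μ (η * Complex.I) - (σ ^ 2 * g : ℝ)‖ ^ 3) (𝓝[>] 0)
      (𝓝 0) := by
    refine tendsto_of_tendsto_of_tendsto_of_le_of_le' tendsto_const_nhds ?_
      (Eventually.of_forall fun η => by positivity) hbound
    have : Tendsto (fun η : ℝ => η / K) (𝓝 0) (𝓝 (0 / K)) := tendsto_id.div_const K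
    rw [zero_div] at this
    exact this.mono_left nhdsWithin_le_nhds
  have h3 := hcube.rpow_const (p := (3 : ℝ)⁻¹) (Or.inr (by norm_num))
  rw [Real.zero_rpow (by norm_num)] at h3
  refine h3.congr fun η => ?_
  exact Real.pow_rpow_inv_natCast (norm_nonneg _) three_ne_zero

end

/-! ### The logarithmic potential -/

section

variable {ι : Type*} [Fintype ι] {p lam : ι → ℝ} {σ : ℝ} {μ : Measure ℝ} [IsProbabilityMeasure μ]

/-- The regularized logarithmic potential `∫ ½ log (x² + η²) μ(dx) = ∫ log |x - iη| μ(dx)`. -/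
noncomputable def regLogPotential (μ : Measure ℝ) (η : ℝ) : ℝ :=
  ∫ x, 1 / 2 * Real.log (x ^ 2 + η ^ 2) ∂μ

/-- The function `∑ᵢ pᵢ log (w(z) - λᵢ) + σ²/2 s(z)²`, with `s` the Stieltjes transform of `μ` and
`w(z) = z + σ² s(z)`. The logarithms are those of `w - λᵢ` and not of `λᵢ - w`, so that the
arguments lie in the upper half-plane; the real part does not see the difference. -/
noncomputable def logFormula (p lam : ι → ℝ) (σ : ℝ) (μ : Measure ℝ) (z : ℂ) : ℂ :=
  ∑ i, (p i : ℂ) * Complex.log (subord σ μ z - lam i) +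
    (σ : ℂ) ^ 2 / 2 * resolventTransform μ z ^ 2

theorem integrable_half_log (hx : Integrable (fun x : ℝ => x ^ 2) μ) {η : ℝ} (hη : η ≠ 0) :
    Integrable (fun x : ℝ => 1 / 2 * Real.log (x ^ 2 + η ^ 2)) μ := by
  have hη2 : 0 < η ^ 2 := by positivity
  refine Integrable.mono' (hx.add (integrable_const (|Real.log (η ^ 2)| + η ^ 2)))
    (Measurable.aestronglyMeasurable (by fun_prop)) (ae_of_all _ fun x => ?_)
  have hx2 := sq_nonneg x
  have h1 : Real.log (x ^ 2 + η ^ 2) ≤ x ^ 2 + η ^ 2 := by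
    have := Real.log_le_sub_one_of_pos (x := x ^ 2 + η ^ 2) (by positivity)
    linarith
  have h2 : Real.log (η ^ 2) ≤ Real.log (x ^ 2 + η ^ 2) := Real.log_le_log hη2 (by linarith)
  have h3 := neg_abs_le (Real.log (η ^ 2))
  have h4 := abs_nonneg (Real.log (η ^ 2))
  simp only [Pi.add_apply]
  rw [Real.norm_eq_abs, abs_le]
  constructor <;> linarith

theorem hasDerivAt_regLogPotential (hx : Integrable (fun x : ℝ => x ^ 2) μ) {η : ℝ} (hη : 0 < η) :
    HasDerivAt (regLogPotential μ) (resolventTransform μ (η * Complex.I)).im η := by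
  rw [resolventTransform_mul_I_im μ hη]
  refine (hasDerivAt_integral_of_dominated_loc_of_deriv_le (s := Ioi (η / 2))
    (F := fun η x => 1 / 2 * Real.log (x ^ 2 + η ^ 2)) (F' := fun η x => η / (x ^ 2 + η ^ 2))
    (bound := fun _ => 2 / η) (Ioi_mem_nhds (by linarith))
    (Eventually.of_forall fun η => Measurable.aestronglyMeasurable (by fun_prop))
    (integrable_half_log hx hη.ne') (integrable_div_sq_add_sq μ hη).aestronglyMeasurable
    (ae_of_all _ fun x t ht => ?_) (integrable_const _) (ae_of_all _ fun x t ht => ?_)).2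
  · have ht' : η / 2 < t := ht
    have ht0 : 0 < t := by linarith
    rw [Real.norm_of_nonneg (by positivity), div_le_div_iff₀ (by positivity) hη]
    nlinarith [sq_nonneg x]
  · have ht' : η / 2 < t := ht
    have ht0 : 0 < t := by linarith
    have h1 : HasDerivAt (fun t : ℝ => x ^ 2 + t ^ 2) (2 * t) t := by
      simpa using (hasDerivAt_pow 2 t).const_add (x ^ 2)
    refine ((h1.log (by positivity)).const_mul (1 / 2)).congr_deriv ?_
    ring

theorem tendsto_regLogPotential_sub_log (hx : Integrable (fun x : ℝ => x ^ 2) μ) :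
    Tendsto (fun η => regLogPotential μ η - Real.log η) atTop (𝓝 0) := by
  have hub : Tendsto (fun η : ℝ => (∫ x, x ^ 2 ∂μ) / η ^ 2) atTop (𝓝 0) :=
    tendsto_const_nhds.div_atTop (tendsto_pow_atTop two_ne_zero)
  have hpt : ∀ η : ℝ, 0 < η → regLogPotential μ η - Real.log η =
      ∫ x, (1 / 2 * Real.log (x ^ 2 + η ^ 2) - Real.log η) ∂μ := by
    intro η hη
    rw [integral_sub (integrable_half_log hx hη.ne') (integrable_const _)]
    simp [regLogPotential]
  have hval : ∀ η x : ℝ, 0 < η → 1 / 2 * Real.log (x ^ 2 + η ^ 2) - Real.log η =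
      1 / 2 * Real.log (x ^ 2 / η ^ 2 + 1) := by
    intro η x hη
    have : x ^ 2 / η ^ 2 + 1 = (x ^ 2 + η ^ 2) / η ^ 2 := by field_simp
    rw [this, Real.log_div (by positivity) (by positivity), Real.log_pow]
    push_cast
    ring
  refine tendsto_of_tendsto_of_tendsto_of_le_of_le' tendsto_const_nhds hub ?_ ?_
  · filter_upwards [eventually_gt_atTop 0] with η hη
    rw [hpt η hη]
    refine integral_nonneg fun x => ?_
    simp only [hval η x hη, Pi.zero_apply]
    have : 0 ≤ Real.log (x ^ 2 / η ^ 2 + 1) := Real.log_nonneg (by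
      have : 0 ≤ x ^ 2 / η ^ 2 := by positivity
      linarith)
    positivity
  · filter_upwards [eventually_gt_atTop 0] with η hη
    rw [hpt η hη, ← integral_div]
    refine integral_mono ((integrable_half_log hx hη.ne').sub (integrable_const _))
      (hx.div_const _) fun x => ?_
    simp only [hval η x hη]
    have h0 : 0 ≤ x ^ 2 / η ^ 2 := by positivity
    have := Real.log_le_sub_one_of_pos (x := x ^ 2 / η ^ 2 + 1) (by positivity)
    linarith

/-- As a function of `z` and of the value `s` of the Stieltjes transform, the expression defining
`logFormula` is stationary in `s` by the fixed-point equation; only the explicit dependence on `z`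
contributes. -/
theorem IsSubordinated.hasDerivAt_logFormula (hμ : IsSubordinated p lam σ μ) {z : ℂ}
    (hz : 0 < z.im) :
    HasDerivAt (logFormula p lam σ μ) (-resolventTransform μ z) z := by
  have hs := (differentiableAt_resolventTransform μ hz).hasDerivAt
  set s' := deriv (resolventTransform μ) z
  have hw : HasDerivAt (subord σ μ) (1 + (σ : ℂ) ^ 2 * s') z :=
    (hasDerivAt_id z).add (hs.const_mul _)
  have him : ∀ i, (subord σ μ z - lam i).im = (subord σ μ z).im := fun i => by simp
  have hlog : ∀ i ∈ Finset.univ,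
      HasDerivAt (fun z => (p i : ℂ) * Complex.log (subord σ μ z - lam i))
        ((p i : ℂ) * ((1 + (σ : ℂ) ^ 2 * s') / (subord σ μ z - lam i))) z := by
    intro i _
    refine ((hw.sub_const (lam i : ℂ)).clog ?_).const_mul _
    refine Or.inr ?_
    rw [him]
    exact (subord_im_pos σ μ hz).ne'
  have hsq : HasDerivAt (fun z => (σ : ℂ) ^ 2 / 2 * resolventTransform μ z ^ 2)
      ((σ : ℂ) ^ 2 / 2 * (2 * resolventTransform μ z * s')) z := by
    simpa using (hs.pow 2).const_mul ((σ : ℂ) ^ 2 / 2)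
  refine ((HasDerivAt.fun_sum hlog).add hsq).congr_deriv ?_
  have hsum : ∑ i, (p i : ℂ) * ((1 + (σ : ℂ) ^ 2 * s') / (subord σ μ z - lam i)) =
      -(1 + (σ : ℂ) ^ 2 * s') * resolventTransform μ z := by
    have : resolventTransform μ z = weightedResolvent p lam (subord σ μ z) := hμ z hz
    rw [this, weightedResolvent, Finset.mul_sum]
    refine Finset.sum_congr rfl fun i _ => ?_
    rw [← neg_sub (lam i : ℂ), div_neg, div_eq_mul_inv]
    ring
  rw [hsum]
  ring

theorem logFormula_re (p lam : ι → ℝ) (σ : ℝ) (μ : Measure ℝ) (z : ℂ) :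
    (logFormula p lam σ μ z).re = ∑ i, p i * Real.log ‖subord σ μ z - lam i‖ +
      σ ^ 2 / 2 * (resolventTransform μ z ^ 2).re := by
  have : ((σ : ℂ) ^ 2 / 2) = ((σ ^ 2 / 2 : ℝ) : ℂ) := by push_cast; rfl
  rw [logFormula, this, Complex.add_re, Complex.re_ofReal_mul, Complex.re_sum]
  simp only [Complex.re_ofReal_mul, Complex.log_re]

theorem tendsto_resolventTransform_atTop (μ : Measure ℝ) [IsProbabilityMeasure μ] :
    Tendsto (fun η : ℝ => resolventTransform μ (η * Complex.I)) atTop (𝓝 0) := by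
  refine squeeze_zero_norm' ?_ tendsto_inv_atTop_zero
  filter_upwards [eventually_gt_atTop 0] with η hη
  simpa using norm_resolventTransform_le μ (z := η * Complex.I) (by simpa using hη)

theorem tendsto_logFormula_sub_log (hp1 : ∑ i, p i = 1) (σ : ℝ) (μ : Measure ℝ)
    [IsProbabilityMeasure μ] :
    Tendsto (fun η : ℝ => (logFormula p lam σ μ (η * Complex.I)).re - Real.log η) atTop (𝓝 0) := by
  have hs := tendsto_resolventTransform_atTop μ
  have hinv : Tendsto (fun η : ℝ => ((η⁻¹ : ℝ) : ℂ)) atTop (𝓝 0) := by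
    have := (Complex.continuous_ofReal.tendsto 0).comp (tendsto_inv_atTop_zero (𝕜 := ℝ))
    rw [Complex.ofReal_zero] at this
    exact this
  have hterm : ∀ i, Tendsto (fun η : ℝ =>
      Real.log ‖subord σ μ (η * Complex.I) - lam i‖ - Real.log η) atTop (𝓝 0) := by
    intro i
    have h1 : Tendsto (fun η : ℝ => Complex.I + ((σ : ℂ) ^ 2 *
        resolventTransform μ (η * Complex.I) - lam i) * ((η⁻¹ : ℝ) : ℂ)) atTop (𝓝 Complex.I) := by
      have := (((hs.const_mul ((σ : ℂ) ^ 2)).sub_const (lam i : ℂ)).mul hinv).const_add Complex.I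
      simpa using this
    have h2 := (h1.norm.log (by simp))
    rw [Complex.norm_I, Real.log_one] at h2
    refine h2.congr' ?_
    filter_upwards [eventually_gt_atTop 0] with η hη
    have hη' : (η : ℂ) ≠ 0 := by exact_mod_cast hη.ne'
    have hne : subord σ μ (η * Complex.I) - lam i ≠ 0 := by
      rw [← neg_ne_zero, neg_sub]
      exact ofReal_sub_ne_zero (subord_im_pos σ μ (by simpa using hη)) _
    rw [← Real.log_div (norm_ne_zero_iff.2 hne) hη.ne']
    congr 1
    rw [← Real.norm_of_nonneg hη.le, ← Complex.norm_real, ← norm_div, Complex.norm_real,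
      Real.norm_of_nonneg hη.le]
    congr 1
    simp only [subord]
    push_cast
    field_simp
    ring
  have hsum : Tendsto (fun η : ℝ => ∑ i, p i *
      (Real.log ‖subord σ μ (η * Complex.I) - lam i‖ - Real.log η) +
      σ ^ 2 / 2 * (resolventTransform μ (η * Complex.I) ^ 2).re) atTop (𝓝 0) := by
    have h1 := tendsto_finsetSum (Finset.univ : Finset ι) fun i _ => (hterm i).const_mul (p i)
    have h2 := ((Complex.continuous_re.tendsto _).comp (hs.pow 2)).const_mul (σ ^ 2 / 2)
    simpa using h1.add h2
  refine hsum.congr fun η => ?_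
  simp only [logFormula_re, mul_sub, Finset.sum_sub_distrib, ← Finset.sum_mul, hp1]
  ring

/-- Both sides have the derivative `Im s(iη)` and are `log η + o(1)` at infinity. -/
theorem IsSubordinated.regLogPotential_eq (hμ : IsSubordinated p lam σ μ)
    (hp1 : ∑ i, p i = 1) (hx : Integrable (fun x : ℝ => x ^ 2) μ) {η : ℝ} (hη : 0 < η) :
    regLogPotential μ η = (logFormula p lam σ μ (η * Complex.I)).re := by
  have hd : ∀ t : ℝ, 0 < t → HasDerivAt
      (fun t : ℝ => regLogPotential μ t - (logFormula p lam σ μ (t * Complex.I)).re) 0 t := by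
    intro t ht
    have h1 : HasDerivAt (fun z : ℂ => logFormula p lam σ μ (z * Complex.I))
        (-resolventTransform μ (t * Complex.I) * Complex.I) (t : ℂ) := by
      have hin : HasDerivAt (fun z : ℂ => z * Complex.I) Complex.I (t : ℂ) := by
        simpa using (hasDerivAt_id (t : ℂ)).mul_const Complex.I
      exact (hμ.hasDerivAt_logFormula (by simpa using ht)).comp (t : ℂ) hin
    refine ((hasDerivAt_regLogPotential hx ht).sub h1.real_of_complex).congr_deriv ?_
    simp
  obtain ⟨c, hc⟩ := isOpen_Ioi.exists_is_const_of_deriv_eq_zero (isPreconnected_Ioi (a := (0 : ℝ)))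
    (fun t ht => (hd t ht).differentiableAt.differentiableWithinAt) fun t ht => (hd t ht).deriv
  have hlim : Tendsto (fun t : ℝ =>
      regLogPotential μ t - (logFormula p lam σ μ (t * Complex.I)).re) atTop (𝓝 0) := by
    simpa using (tendsto_regLogPotential_sub_log hx).sub
      (tendsto_logFormula_sub_log (lam := lam) hp1 σ μ)
  have hc0 : c = 0 := tendsto_nhds_unique (tendsto_const_nhds.congr' (by
    filter_upwards [eventually_gt_atTop 0] with t ht using (hc t ht).symm)) hlim
  have := hc η hη
  rw [hc0] at this
  linarith

theorem IsSubordinated.tendsto_regLogPotential (hμ : IsSubordinated p lam σ μ) (hσ : 0 < σ)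
    [Nonempty ι] (hp : ∀ i, 0 < p i) (hp1 : ∑ i, p i = 1)
    (hx : Integrable (fun x : ℝ => x ^ 2) μ) {g : ℝ} (hg : ∀ i, 0 < lam i - σ ^ 2 * g)
    (hfix : g = ∑ i, p i * (lam i - σ ^ 2 * g)⁻¹)
    (hstab : σ ^ 2 * ∑ i, p i * (lam i - σ ^ 2 * g)⁻¹ ^ 2 ≤ 1) :
    Tendsto (regLogPotential μ) (𝓝[>] 0) (𝓝 (potential σ p lam g)) := by
  have hw := hμ.tendsto_subord hσ hp hp1 hg hfix hstab
  have hs : Tendsto (fun η : ℝ => resolventTransform μ (η * Complex.I)) (𝓝[>] 0) (𝓝 (g : ℂ)) := by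
    have hη : Tendsto (fun η : ℝ => (η : ℂ) * Complex.I) (𝓝[>] 0) (𝓝 0) := by
      have : Continuous fun η : ℝ => (η : ℂ) * Complex.I := by fun_prop
      simpa using (this.tendsto 0).mono_left nhdsWithin_le_nhds
    have hσ0 : (σ : ℂ) ≠ 0 := by exact_mod_cast hσ.ne'
    have h := (hw.sub hη).div_const ((σ : ℂ) ^ 2)
    have hgeq : (((σ ^ 2 * g : ℝ) : ℂ) - 0) / (σ : ℂ) ^ 2 = g := by
      push_cast
      field_simp
      rw [sub_zero]
    rw [hgeq] at h
    refine h.congr fun η => ?_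
    simp only [subord]
    rw [add_sub_cancel_left]
    field_simp
  have hlog : ∀ i, Tendsto (fun η : ℝ => p i * Real.log ‖subord σ μ (η * Complex.I) - lam i‖)
      (𝓝[>] 0) (𝓝 (p i * Real.log (lam i - σ ^ 2 * g))) := by
    intro i
    have hn : ‖((σ ^ 2 * g : ℝ) : ℂ) - lam i‖ = lam i - σ ^ 2 * g := by
      rw [← Complex.ofReal_sub, Complex.norm_real, Real.norm_eq_abs, abs_sub_comm,
        abs_of_pos (hg i)]
    have h := (hw.sub_const (lam i : ℂ)).norm
    rw [hn] at h
    exact (h.log (hg i).ne').const_mul _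
  have hsq := ((Complex.continuous_re.tendsto _).comp (hs.pow 2)).const_mul (σ ^ 2 / 2)
  have hall := (tendsto_finsetSum (Finset.univ : Finset ι) fun i _ => hlog i).add hsq
  have hval : ∑ i, p i * Real.log (lam i - σ ^ 2 * g) + σ ^ 2 / 2 * ((g : ℂ) ^ 2).re =
      potential σ p lam g := by
    rw [potential, ← Complex.ofReal_pow, Complex.ofReal_re, add_comm]
  rw [hval] at hall
  refine hall.congr' ?_
  filter_upwards [self_mem_nhdsWithin] with η hη
  rw [hμ.regLogPotential_eq hp1 hx hη, logFormula_re]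
  rfl

/-- The mass of an atom at `0` is at most `η Im s(iη)`, and `s` is bounded. -/
theorem IsSubordinated.measure_singleton_zero (hμ : IsSubordinated p lam σ μ) (hσ : 0 < σ)
    (hp : ∀ i, 0 ≤ p i) (hp1 : ∑ i, p i = 1) : μ {0} = 0 := by
  have hle : ∀ η : ℝ, 0 < η → μ.real {0} ≤ η * σ⁻¹ := by
    intro η hη
    have hz : 0 < ((η : ℂ) * Complex.I).im := by simpa using hη
    calc μ.real {0} = ∫ x, ({0} : Set ℝ).indicator 1 x ∂μ := by
          rw [integral_indicator_one (measurableSet_singleton 0)]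
      _ ≤ ∫ x, η * (η / (x ^ 2 + η ^ 2)) ∂μ := by
          refine integral_mono ((integrable_const (1 : ℝ)).indicator (measurableSet_singleton 0))
            ((integrable_div_sq_add_sq μ hη).const_mul η) fun x => ?_
          by_cases hx : x = 0
          · subst hx
            simp
            field_simp
            rfl
          · simp [hx]
            positivity
      _ = η * (resolventTransform μ (η * Complex.I)).im := by
          rw [integral_const_mul, resolventTransform_mul_I_im μ hη]
      _ ≤ η * σ⁻¹ := by
          gcongr
          exact ((le_abs_self _).trans (Complex.abs_im_le_norm _)).trans (hμ.norm_le hp hp1 hσ hz)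
  have h0 : μ.real {0} ≤ 0 := by
    refine ge_of_tendsto (x := 𝓝[>] (0 : ℝ)) (f := fun η : ℝ => η * σ⁻¹) ?_ ?_
    · have : Tendsto (fun η : ℝ => η * σ⁻¹) (𝓝 0) (𝓝 (0 * σ⁻¹)) := tendsto_id.mul_const _
      rw [zero_mul] at this
      exact this.mono_left nhdsWithin_le_nhds
    · filter_upwards [self_mem_nhdsWithin] with η hη using hle η hη
  exact (measureReal_eq_zero_iff).1 (le_antisymm h0 measureReal_nonneg)

/-- Monotone convergence as `η ↓ 0`. The atom at `0` has to be excluded separately, because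
`Real.log 0 = 0`. -/
theorem integral_log_abs_eq_of_tendsto (hx : Integrable (fun x : ℝ => x ^ 2) μ) (h0 : μ {0} = 0)
    {ℓ : ℝ} (h : Tendsto (regLogPotential μ) (𝓝[>] 0) (𝓝 ℓ)) :
    Integrable (fun x : ℝ => Real.log |x|) μ ∧ ∫ x, Real.log |x| ∂μ = ℓ := by
  let e : ℕ → ℝ := fun n => 1 / ((n : ℝ) + 1)
  let f : ℕ → ℝ → ℝ := fun n x => 1 / 2 * Real.log (x ^ 2 + e n ^ 2)
  have he0 : ∀ n, 0 < e n := fun n => Nat.one_div_pos_of_nat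
  have hlim0 : Tendsto e atTop (𝓝 0) := tendsto_one_div_add_atTop_nhds_zero_nat
  have hlim : Tendsto e atTop (𝓝[>] 0) :=
    tendsto_nhdsWithin_iff.2 ⟨hlim0, Eventually.of_forall he0⟩
  have hf : ∀ n, Integrable (f n) μ := fun n => integrable_half_log hx (he0 n).ne'
  have hanti : ∀ x, Antitone fun n => f n x := by
    intro x m n hmn
    have := he0 n
    have : e n ≤ e m := Nat.one_div_le_one_div hmn
    simp only [f]
    gcongr
  have hne : ∀ᵐ x ∂μ, x ≠ 0 := by
    rw [ae_iff]
    simpa using h0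
  have hpt : ∀ᵐ x ∂μ, Tendsto (fun n => f n x) atTop (𝓝 (Real.log |x|)) := by
    filter_upwards [hne] with x hx0
    have h1 : Tendsto (fun n => x ^ 2 + e n ^ 2) atTop (𝓝 (x ^ 2)) := by
      simpa using (hlim0.pow 2).const_add (x ^ 2)
    have h2 := (h1.log (by positivity)).const_mul (1 / 2)
    rw [Real.log_pow] at h2
    rw [Real.log_abs]
    convert h2 using 2
    push_cast
    ring
  have hint : Tendsto (fun n => ∫ x, f n x ∂μ) atTop (𝓝 ℓ) := h.comp hlim
  have hdiff : Integrable (fun x : ℝ => f 0 x - Real.log |x|) μ := by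
    refine integrable_of_tendsto (G := fun n x => f 0 x - f n x) ?_
      (fun n => ((hf 0).sub (hf n)).aestronglyMeasurable) ?_
    · filter_upwards [hpt] with x hx using hx.const_sub _
    · have heq : ∀ n, ∫⁻ x, ‖f 0 x - f n x‖ₑ ∂μ =
          ENNReal.ofReal (∫ x, f 0 x ∂μ - ∫ x, f n x ∂μ) := by
        intro n
        have hsub : Integrable (fun x => f 0 x - f n x) μ := (hf 0).sub (hf n)
        rw [← integral_sub (hf 0) (hf n), ofReal_integral_eq_lintegral_ofReal hsub
          (ae_of_all _ fun x => sub_nonneg.2 (hanti x (Nat.zero_le n)))]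
        exact lintegral_congr fun x =>
          Real.enorm_of_nonneg (sub_nonneg.2 (hanti x (Nat.zero_le n)))
      simp only [heq]
      rw [(ENNReal.tendsto_ofReal (hint.const_sub _)).liminf_eq]
      exact ENNReal.ofReal_ne_top
  have hlog : Integrable (fun x : ℝ => Real.log |x|) μ := by
    refine ((hf 0).sub hdiff).congr (ae_of_all _ fun x => ?_)
    simp
  exact ⟨hlog, tendsto_nhds_unique
    (integral_tendsto_of_tendsto_of_antitone hf hlog (ae_of_all _ hanti) hpt) hint⟩

end

/-! ### Application to the matrix `D_N(m)` -/

/-- `eigenvalues` lists the diagonal entries in an unspecified order, so only symmetric sums agree. -/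
theorem sum_eigenvalues_diagonal {N : ℕ} {E : Type*} [AddCommMonoid E] {d : Fin N → ℝ}
    (h : (Matrix.diagonal d).IsHermitian) (f : ℝ → E) :
    ∑ j, f (h.eigenvalues j) = ∑ j, f (d j) := by
  have hroots := h.roots_charpoly_eq_eigenvalues
  have hprod : (Matrix.diagonal d).charpoly =
      ((Finset.univ.val.map d).map fun a => Polynomial.X - Polynomial.C a).prod := by
    rw [Matrix.charpoly_diagonal, Multiset.map_map]
    rfl
  rw [hprod, Polynomial.roots_multiset_prod_X_sub_C] at hroots
  have := congrArg (fun s : Multiset ℝ => (s.map f).sum) hroots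
  simp only [Multiset.map_map] at this
  exact this.symm

theorem resolventTransform_empiricalSpectralMeasure {N : ℕ} (β : ℝ)
    (m : EuclideanSpace ℝ (Fin N)) {w : ℂ} (hw : 0 < w.im) :
    resolventTransform (empiricalSpectralMeasure (isHermitian_D β m)) w =
      weightedResolvent (fun _ => 1 / (N : ℝ))
        (fun i => (1 - m i ^ 2)⁻¹ + 2 * β ^ 2 * (1 - Q m)) w := by
  rw [resolventTransform_eq_integral, empiricalSpectralMeasure, integral_smul_measure,
    integral_finsetSum_measure fun k _ => integrable_inv_ofReal_sub _ hw]
  simp only [integral_dirac]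
  have := sum_eigenvalues_diagonal (isHermitian_D β m) fun x : ℝ => ((x : ℂ) - w)⁻¹
  rw [show ∑ j, (((isHermitian_D β m).eigenvalues j : ℂ) - w)⁻¹ = _ from this,
    weightedResolvent, ← Finset.mul_sum]
  simp

theorem isSemicircleConv_empiricalSpectralMeasure_iff {N : ℕ} (β σ : ℝ)
    (m : EuclideanSpace ℝ (Fin N)) (μ : Measure ℝ) :
    IsSemicircleConv (empiricalSpectralMeasure (isHermitian_D β m)) σ μ ↔
      IsProbabilityMeasure μ ∧ IsSubordinated (fun _ => 1 / (N : ℝ))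
        (fun i => (1 - m i ^ 2)⁻¹ + 2 * β ^ 2 * (1 - Q m)) σ μ := by
  refine and_congr_right fun _ => forall₂_congr fun z hz => ?_
  have h := resolventTransform_empiricalSpectralMeasure β m (subord_im_pos σ μ hz)
  rw [subord] at h
  rw [h]

/-- The free convolution exists, so `mu β m` is not the dummy value of `semicircleConv`. -/
theorem mu_spec {N : ℕ} [NeZero N] {β : ℝ} (hβ : 0 < β) (m : EuclideanSpace ℝ (Fin N)) :
    IsProbabilityMeasure (mu β m) ∧ IsSubordinated (fun _ => 1 / (N : ℝ))
        (fun i => (1 - m i ^ 2)⁻¹ + 2 * β ^ 2 * (1 - Q m)) (√2 * β) (mu β m) := by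
  have hN : (N : ℝ) ≠ 0 := NeZero.ne _
  have hex : ∃ μ, IsSemicircleConv (empiricalSpectralMeasure (isHermitian_D β m)) (√2 * β) μ := by
    simp only [isSemicircleConv_empiricalSpectralMeasure_iff]
    exact exists_subordinated_measure (fun _ => by positivity) (by simp [hN]) _ (by positivity)
  rw [← isSemicircleConv_empiricalSpectralMeasure_iff, mu, semicircleConv, dif_pos hex]
  exact hex.choose_spec

theorem potential_eq_R {N : ℕ} (β : ℝ) (m : EuclideanSpace ℝ (Fin N)) :
    potential (√2 * β) (fun _ => 1 / (N : ℝ))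
      (fun i => (1 - m i ^ 2)⁻¹ + 2 * β ^ 2 * (1 - Q m)) = R β m := by
  ext g
  have h2 : (√2 * β) ^ 2 = 2 * β ^ 2 := by rw [mul_pow, Real.sq_sqrt zero_le_two]
  rw [potential, R, h2, Finset.mul_sum]
  ring

/-- This identity makes `1 - Q(m)` a critical point of `R β m`. -/
theorem sum_one_sub_sq {N : ℕ} [NeZero N] (m : EuclideanSpace ℝ (Fin N)) :
    ∑ i, 1 / (N : ℝ) * (1 - m i ^ 2) = 1 - Q m := by
  have hN : (N : ℝ) ≠ 0 := NeZero.ne _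
  rw [← Finset.mul_sum, Finset.sum_sub_distrib, Q, EuclideanSpace.real_norm_sq_eq]
  simp
  field_simp

theorem one_sub_sq_pos_of_mem_L {α : ℝ} {N : ℕ} {m : EuclideanSpace ℝ (Fin N)} (hm : m ∈ L α N)
    (i : Fin N) : 0 < 1 - m i ^ 2 := by
  obtain ⟨h1, h2⟩ := hm.1 i
  have := Real.exp_pos (-(α * √(N : ℝ)))
  nlinarith

end BrayMoore

open BrayMoore in
theorem proposition5p1 (α β : ℝ) (hα : 0 < α) (hβ : 0 < β) (N : ℕ)
    (m : EuclideanSpace ℝ (Fin N)) (hm : m ∈ BrayMoore.L α N) :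
    -- the integral of `log |x|` is a genuine one
    BrayMoore.mu β m {0} = 0 ∧
    Integrable (fun x : ℝ => Real.log |x|) (BrayMoore.mu β m) ∧
    -- it equals the minimum of `R` over `g ≤ 1 - Q(m)`
    IsLeast (BrayMoore.R β m '' Iic (1 - BrayMoore.Q m))
      (∫ x, Real.log |x| ∂(BrayMoore.mu β m)) ∧
    -- the minimum is attained at exactly one point, which lies in `[0, 1 - Q(m)]`
    (∃ g ∈ Icc 0 (1 - BrayMoore.Q m),
      IsMinOn (BrayMoore.R β m) (Iic (1 - BrayMoore.Q m)) g ∧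
      ∀ g' ∈ Iic (1 - BrayMoore.Q m),
        IsMinOn (BrayMoore.R β m) (Iic (1 - BrayMoore.Q m)) g' → g' = g) ∧
    -- it is attained at `g = 1 - Q(m)` iff the Plefka condition holds
    (IsMinOn (BrayMoore.R β m) (Iic (1 - BrayMoore.Q m)) (1 - BrayMoore.Q m) ↔
      2 * β ^ 2 * ∑ i, (1 - m i ^ 2) ^ 2 ≤ (N : ℝ)) := by
  have hN : NeZero N := ⟨by rintro rfl; exact hm.2 (Subsingleton.elim _ _)⟩
  have hN0 : 0 < (N : ℝ) := by exact_mod_cast Nat.pos_of_neZero N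
  have hm1 := one_sub_sq_pos_of_mem_L hm
  have hσ : 0 < √2 * β := by positivity
  have hσ2 : (√2 * β) ^ 2 = 2 * β ^ 2 := by rw [mul_pow, Real.sq_sqrt zero_le_two]
  have hp : ∀ _ : Fin N, 0 < 1 / (N : ℝ) := fun _ => by positivity
  have hp1 : ∑ _ : Fin N, 1 / (N : ℝ) = 1 := by simp [hN0.ne']
  have hG0 : 0 < 1 - Q m := by
    rw [← sum_one_sub_sq]
    exact Finset.sum_pos (fun i _ => mul_pos (hp i) (hm1 i)) Finset.univ_nonempty
  set lam : Fin N → ℝ := fun i => (1 - m i ^ 2)⁻¹ + 2 * β ^ 2 * (1 - Q m) with hlam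
  have hlamG : ∀ i, lam i - (√2 * β) ^ 2 * (1 - Q m) = (1 - m i ^ 2)⁻¹ := fun i => by
    rw [hσ2, hlam]; ring
  have hlam0 : ∀ i, 0 < lam i := fun i => by
    have := hm1 i
    positivity
  have hG : ∀ i, 0 < lam i - (√2 * β) ^ 2 * (1 - Q m) := fun i => by
    rw [hlamG]
    exact inv_pos.2 (hm1 i)
  have hfixG : 1 - Q m = ∑ i, 1 / (N : ℝ) * (lam i - (√2 * β) ^ 2 * (1 - Q m))⁻¹ := by
    simp only [hlamG, inv_inv, sum_one_sub_sq]
  have hPlefka : (√2 * β) ^ 2 * ∑ i, 1 / (N : ℝ) * (lam i - (√2 * β) ^ 2 * (1 - Q m))⁻¹ ^ 2 ≤ 1 ↔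
      2 * β ^ 2 * ∑ i, (1 - m i ^ 2) ^ 2 ≤ (N : ℝ) := by
    simp only [hlamG, inv_inv]
    rw [hσ2, ← Finset.mul_sum]
    rw [← div_le_one hN0]
    exact iff_of_eq (congrArg (· ≤ (1 : ℝ)) (by ring))
  obtain ⟨g, hg, hfix, hstab, hanti, hmono, hiff⟩ :=
    exists_potential_minimizer hσ hp hlam0 hG0 hG hfixG
  rw [hPlefka] at hiff
  rw [potential_eq_R] at hanti hmono
  have hlt : ∀ g' ∈ Iic (1 - Q m), g' ≠ g → R β m g < R β m g' := by
    intro g' hg' hne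
    rcases lt_or_gt_of_ne hne with h | h
    · exact hanti h.le self_mem_Iic h
    · exact hmono (left_mem_Icc.2 hg.2) ⟨h.le, hg'⟩ h
  have hmin : IsMinOn (R β m) (Iic (1 - Q m)) g := by
    intro g' hg'
    rcases eq_or_ne g' g with rfl | h
    · exact le_refl (R β m g')
    · exact (hlt g' hg' h).le
  have huniq : ∀ g' ∈ Iic (1 - Q m), IsMinOn (R β m) (Iic (1 - Q m)) g' → g' = g := by
    intro g' hg' hmin'
    by_contra hne
    exact (hlt g' hg' hne).not_ge (hmin' (mem_Iic.2 hg.2))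
  obtain ⟨hprob, hμ⟩ := mu_spec hβ m
  obtain ⟨A, hA⟩ : ∃ A, ∀ i, |lam i| ≤ A := Finite.bddAbove_range (fun i => |lam i|) |>.imp
    fun A h i => h (mem_range_self i)
  have hsq : Integrable (fun x : ℝ => x ^ 2) (mu β m) :=
    (lintegral_ofReal_ne_top_iff_integrable (by fun_prop) (ae_of_all _ fun x => sq_nonneg x)).1
      (ne_top_of_le_ne_top ENNReal.ofReal_ne_top
        (lintegral_sq_le_of_subordination (fun i => (hp i).le) hp1 hA _ _ hμ))
  have hzero := hμ.measure_singleton_zero hσ (fun i => (hp i).le) hp1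
  obtain ⟨hint, hval⟩ := integral_log_abs_eq_of_tendsto hsq hzero
    (hμ.tendsto_regLogPotential hσ hp hp1 hsq
      (fun i => sub_mul_pos_of_le (hG i) hg.2) hfix hstab)
  rw [potential_eq_R] at hval
  refine ⟨hzero, hint, ?_, ⟨g, hg, hmin, huniq⟩, ?_⟩
  · rw [hval]
    exact ⟨mem_image_of_mem _ hg.2, by rintro _ ⟨g', hg', rfl⟩; exact hmin hg'⟩
  · rw [← hiff]
    exact ⟨fun h => (huniq _ self_mem_Iic h).symm, fun h => h ▸ hmin⟩
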